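/- Let $K_1$ and $K_2$ be number fields with rings of integers $R_1$ and $R_2$, let $\mathcal S\subsetneq\mathcal P_{K_1}$ and $\mathcal T\subsetneq\mathcal P_{K_2}$ be proper (possibly empty or infinite) subsets of the sets of non-zero prime ideals, and let $R_{1,\mathcal S}=\{x\in K_1 : |x|_{\mathfrak p}\le 1 \text{ for all }\mathfrak p\notin\mathcal S\}$ and $R_{2,\mathcal T}\subseteq K_2$ be the corresponding rings of $\mathcal S$- and $\mathcal T$-integers. Let $\xi\in R_1\setminus\{0\}$ be a non-unit of $R_{1,\mathcal S}$ and let $\eta\in R_2\setminus\{0\}$ be a non-unit of $R_{2,\mathcal T}$. Let $A=R_{1,\mathcal S}$, let $\mathscr A=R_{1,\mathcal S}[1/\xi]\subseteq K_1$ and let $\langle\xi\rangle$ be the multiplicative group generated by $\xi$, acting on $\mathscr A$ by multiplication. Let $\mathcal C$ be the smallest family of subgroups of $A$ that contains $A$ and contains $\xi^nC$ and $\{a\in A:\xi^na\in C\}$ for all $C\in\mathcal C$ and $n\ge 0$, and let $\overline A=\varprojlim_{C\in\mathcal C}A/C$ with the projective limit topology (each $A/C$ being discrete). The group $\mathscr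 A\rtimes\langle\xi\rangle$ acts on $\mathscr A$ by $(z,\gamma).x=z+\gamma x$. For each $g\in\mathscr A\rtimes\langle\xi\rangle$, the partial bijection $A\cap g^{-1}.A\to g.A\cap A$, $a\mapsto g.a$, extends by continuity to a partial homeomorphism of $\overline A$, defined on the closure of the image of $A\cap g^{-1}.A$ in $\overline A$. The topological groupoid $(\mathscr A\rtimes\langle\xi\rangle)\ltimes\overline A$ consists of the pairs $(g,\boldsymbol x)$ with $\boldsymbol x\in\overline A$ in the domain of $g$, with source $\boldsymbol x$, range $g.\boldsymbol x$, product $(g,h.\boldsymbol x)(h,\boldsymbol x)=(gh,\boldsymbol x)$, and the topology induced from the product of the discrete group $\mathscr A\rtimes\langle\xi\rangle$ and $\overline A$. Define $(R_{2,\mathcal T}[1/\eta]\rtimes\langle\eta\rangle)\ltimes\overline{R_{2,\mathcal T}}$ in the same way. If there is an isomorphism of topological groupoids \[ (R_{1,\mathcal S}[1/\xi]\rtimes\langle\xi\rangle)\ltimes\overline{R_{1,\mathcal S}}\;\cong\;(R_{2,\mathcal T}[1/\eta]\rtimes\langle\eta\rangle)\ltimes\overline{R_{2,\mathcal T}}, \]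 then the $\mathbb Z$-actions $\tilde m_\xi$ on $R_{1,\mathcal S}[1/\xi]$ and $\tilde m_\eta$ on $R_{2,\mathcal T}[1/\eta]$, in which $n\in\mathbb Z$ acts as multiplication by $\xi^n$ and by $\eta^n$, respectively, are finitely algebraically equivalent. That is, there are an automorphism $\mathfrak t$ of $\mathbb Z$ and an injective homomorphism of additive groups $\mathfrak b\colon R_{1,\mathcal S}[1/\xi]\to R_{2,\mathcal T}[1/\eta]$ with image of finite index such that $\mathfrak b(\xi^nx)=\eta^{\mathfrak t(n)}\mathfrak b(x)$ for all $n\in\mathbb Z$ and $x\in R_{1,\mathcal S}[1/\xi]$, and there is likewise such a pair from $\tilde m_\eta$ to $\tilde m_\xi$. -/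

import Mathlib

open NumberField IsDedekindDomain

universe u v

noncomputable section

/-! ## Topological groupoids -/

/-- A topological groupoid: a small groupoid with unit space `Obj` and space of arrows `Arr`,
both topologised, such that all structure maps are continuous.  An arrow `p` goes from `source p`
to `range p`, and `mul p q` (first `q`, then `p`) is defined when `source p = range q`. -/
structure TopGroupoid where
  Obj : Type u
  Arr : Type u
  [topObj : TopologicalSpace Obj]
  [topArr : TopologicalSpace Arr]
  source : Arr → Obj
  range : Arr → Obj
  unit : Obj → Arr
  mul : (p q : Arr) → source p = range q → Arr
  inv : Arr → Arr
  source_unit : ∀ x, source (unit x) = x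
  range_unit : ∀ x, range (unit x) = x
  source_mul : ∀ p q h, source (mul p q h) = source q
  range_mul : ∀ p q h, range (mul p q h) = range p
  source_inv : ∀ p, source (inv p) = range p
  range_inv : ∀ p, range (inv p) = source p
  unit_mul : ∀ p, mul (unit (range p)) p (source_unit _) = p
  mul_unit : ∀ p, mul p (unit (source p)) (range_unit _).symm = p
  mul_assoc : ∀ p q r (h : source p = range q) (k : source q = range r),
    mul (mul p q h) r ((source_mul p q h).trans k) =
      mul p (mul q r k) (h.trans (range_mul q r k).symm)
  inv_mul : ∀ p, mul (inv p) p (source_inv p) = unit (source p)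
  mul_inv : ∀ p, mul p (inv p) (range_inv p).symm = unit (range p)
  continuous_source : Continuous source
  continuous_range : Continuous range
  continuous_unit : Continuous unit
  continuous_inv : Continuous inv
  continuous_mul :
    Continuous fun pq : {pq : Arr × Arr // source pq.1 = range pq.2} => mul pq.1.1 pq.1.2 pq.2

attribute [instance] TopGroupoid.topObj TopGroupoid.topArr

/-- An isomorphism of topological groupoids: homeomorphisms on units and on arrows that respect
source, range and multiplication (hence also units and inverses). -/
structure TopGroupoid.Iso (𝒢 : TopGroupoid.{u}) (ℋ : TopGroupoid.{v}) where
  obj : 𝒢.Obj ≃ₜ ℋ.Obj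
  arr : 𝒢.Arr ≃ₜ ℋ.Arr
  source_arr : ∀ p, ℋ.source (arr p) = obj (𝒢.source p)
  range_arr : ∀ p, ℋ.range (arr p) = obj (𝒢.range p)
  map_mul : ∀ p q (h : 𝒢.source p = 𝒢.range q),
    arr (𝒢.mul p q h) =
      ℋ.mul (arr p) (arr q) (by rw [source_arr, range_arr, h])

/-! ## Algebraic actions with a globalization -/

/-- A globalized algebraic action: an action `σ` of a group `G` on an abelian group `M` by
automorphisms, together with a submonoid `S` generating `G` and a subgroup `A` of `M` which is
stable under `S`.  The underlying algebraic action is the one of `S` on `A`. -/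
structure GlobalizedAction (G M : Type u) [Group G] [AddCommGroup M] where
  σ : G →* Multiplicative (AddAut M)
  S : Submonoid G
  A : AddSubgroup M
  closure_S : Subgroup.closure (S : Set G) = ⊤
  stable : ∀ s ∈ S, ∀ a ∈ A, (σ s).toAdd a ∈ A

namespace GlobalizedAction

variable {G M : Type u} [Group G] [AddCommGroup M] (X : GlobalizedAction G M)

/-- The injective endomorphism of `A` by which `s ∈ S` acts. -/
def endo (s : X.S) : X.A →+ X.A where
  toFun a := ⟨(X.σ s).toAdd a, X.stable s s.2 a a.2⟩
  map_zero' := Subtype.ext (map_zero (X.σ s).toAdd)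
  map_add' a b := Subtype.ext (map_add (X.σ s).toAdd (a : M) (b : M))

/-- The family of constructible subgroups of `A`: the smallest family that contains `A` and is
closed under images and preimages under the endomorphisms given by `S`. -/
inductive IsConstructible : AddSubgroup X.A → Prop
  | top : IsConstructible ⊤
  | map (s : X.S) (C : AddSubgroup X.A) : IsConstructible C → IsConstructible (C.map (X.endo s))
  | comap (s : X.S) (C : AddSubgroup X.A) :
      IsConstructible C → IsConstructible (C.comap (X.endo s))

/-- The completion `Ā = lim A / C`, the limit being over all constructible subgroups `C`. -/
def Completion : Type u :=
  {x : (C : {C : AddSubgroup X.A // X.IsConstructible C}) → X.A ⧸ C.1 //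
    ∀ C D (h : C.1 ≤ D.1), QuotientAddGroup.map C.1 D.1 (AddMonoidHom.id X.A) h (x C) = x D}

/-- The projective limit topology, each `A / C` being discrete. -/
instance : TopologicalSpace X.Completion :=
  .induced Subtype.val (@Pi.topologicalSpace _ _ fun _ => ⊥)

/-- The canonical map `A → Ā`. -/
def toCompletion (a : X.A) : X.Completion :=
  ⟨fun _ => (a : X.A ⧸ _), fun _ _ _ => rfl⟩

/-- The semidirect product `M ⋊ G`. -/
def AffineGroup : Type u :=
  Multiplicative M ⋊[(MulAutMultiplicative M).symm.toMonoidHom.comp X.σ] G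

instance : Group X.AffineGroup :=
  inferInstanceAs (Group (Multiplicative M ⋊[(MulAutMultiplicative M).symm.toMonoidHom.comp X.σ] G))

instance : TopologicalSpace X.AffineGroup := ⊥

instance : DiscreteTopology X.AffineGroup := ⟨rfl⟩

/-- The affine action of `M ⋊ G` on `M`: `(z, γ).x = z + σ_γ x`. -/
def affine (g : X.AffineGroup) (x : M) : M :=
  (SemidirectProduct.left g).toAdd + (X.σ (SemidirectProduct.right g)).toAdd x

/-- The graph, seen in `Ā × Ā`, of the partial bijection `A ∩ g⁻¹.A → g.A ∩ A`, `a ↦ g.a`. -/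
def partialGraph (g : X.AffineGroup) : Set (X.Completion × X.Completion) :=
  {p | ∃ a b : X.A, X.affine g a = b ∧ p = (X.toCompletion a, X.toCompletion b)}

/-- `X.Maps g x y` means that `x ∈ Ā` lies in the domain of the extension to `Ā` of the partial
bijection of `A` given by `g`, and that the extension maps `x` to `y`. -/
def Maps (g : X.AffineGroup) (x y : X.Completion) : Prop :=
  (x, y) ∈ closure (X.partialGraph g)

/-! ### Helper facts: `Maps` is a partial action by partial homeomorphisms -/

lemma affine_mul (g h : X.AffineGroup) (x : M) :
    X.affine (g * h) x = X.affine g (X.affine h x) := by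
  have h1 : (SemidirectProduct.left (g * h)).toAdd = (SemidirectProduct.left g).toAdd +
      (X.σ (SemidirectProduct.right g)).toAdd (SemidirectProduct.left h).toAdd := rfl
  have h2 : (X.σ (SemidirectProduct.right (g * h))).toAdd x =
      (X.σ (SemidirectProduct.right g)).toAdd ((X.σ (SemidirectProduct.right h)).toAdd x) := by
    change (X.σ (SemidirectProduct.right g * SemidirectProduct.right h)).toAdd x = _
    rw [map_mul]
    rfl
  unfold affine
  rw [h1, h2, map_add, add_assoc]

lemma affine_one (x : M) : X.affine 1 x = x := by
  have h1 : (SemidirectProduct.left (1 : X.AffineGroup)).toAdd = (0 : M) := rfl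
  have h2 : (X.σ (SemidirectProduct.right (1 : X.AffineGroup))).toAdd x = x := by
    change (X.σ 1).toAdd x = x
    rw [map_one]
    rfl
  unfold affine
  rw [h1, h2, zero_add]

lemma affine_sub (g : X.AffineGroup) (x y : M) :
    X.affine g x - X.affine g y = (X.σ (SemidirectProduct.right g)).toAdd (x - y) := by
  simp [affine]

lemma endo_injective (s : X.S) : Function.Injective (X.endo s) := fun _ _ h =>
  Subtype.ext ((X.σ s).toAdd.injective (congrArg Subtype.val h))

lemma IsConstructible.inf {C D : AddSubgroup X.A} (hC : X.IsConstructible C)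
    (hD : X.IsConstructible D) : X.IsConstructible (C ⊓ D) := by
  induction hC generalizing D with
  | top => simpa using hD
  | map s C _ ih =>
    have : C.map (X.endo s) ⊓ D = (C ⊓ D.comap (X.endo s)).map (X.endo s) := by
      ext x
      simp only [AddSubgroup.mem_inf, AddSubgroup.mem_map, AddSubgroup.mem_comap]
      constructor
      · rintro ⟨⟨c, hc, rfl⟩, hx⟩
        exact ⟨c, ⟨hc, hx⟩, rfl⟩
      · rintro ⟨c, ⟨hc, hx⟩, rfl⟩
        exact ⟨⟨c, hc, rfl⟩, hx⟩
    rw [this]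
    exact .map s _ (ih (.comap s _ hD))
  | comap s C _ ih =>
    have : C.comap (X.endo s) ⊓ D = (C ⊓ D.map (X.endo s)).comap (X.endo s) := by
      ext x
      simp only [AddSubgroup.mem_inf, AddSubgroup.mem_map, AddSubgroup.mem_comap]
      constructor
      · rintro ⟨hc, hx⟩
        exact ⟨hc, x, hx, rfl⟩
      · rintro ⟨hc, y, hy, h⟩
        exact ⟨hc, X.endo_injective s h ▸ hy⟩
    rw [this]
    exact .comap s _ (ih (.map s _ hD))

/-- Each `σ_γ` is continuous at `0` for the topology given by the constructible subgroups. -/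
lemma exists_constructible (γ : G) {C : AddSubgroup X.A} (hC : X.IsConstructible C) :
    ∃ D, X.IsConstructible D ∧ ∀ d ∈ D, ∃ c ∈ C, (X.σ γ).toAdd (d : M) = (c : M) := by
  have hγ : γ ∈ Subgroup.closure (X.S : Set G) := X.closure_S ▸ Subgroup.mem_top γ
  induction hγ using Subgroup.closure_induction'' generalizing C with
  | one => exact ⟨C, hC, fun d hd => ⟨d, hd, by rw [map_one]; rfl⟩⟩
  | mem s hs =>
    exact ⟨C.comap (X.endo ⟨s, hs⟩), .comap _ _ hC, fun d hd => ⟨_, hd, rfl⟩⟩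
  | inv_mem s hs =>
    refine ⟨C.map (X.endo ⟨s, hs⟩), .map _ _ hC, ?_⟩
    rintro _ ⟨c, hc, rfl⟩
    refine ⟨c, hc, ?_⟩
    rw [map_inv]
    exact (X.σ s).toAdd.symm_apply_apply (c : M)
  | mul α β _ _ hα hβ =>
    obtain ⟨D, hD, h⟩ := hα hC
    obtain ⟨E, hE, k⟩ := hβ hD
    refine ⟨E, hE, fun e he => ?_⟩
    obtain ⟨d, hd, hed⟩ := k e he
    obtain ⟨c, hc, hdc⟩ := h d hd
    refine ⟨c, hc, ?_⟩
    rw [map_mul]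
    change (X.σ α).toAdd ((X.σ β).toAdd (e : M)) = c
    rw [hed, hdc]

lemma isOpen_coord (C : {C : AddSubgroup X.A // X.IsConstructible C}) (t : Set (X.A ⧸ C.1)) :
    IsOpen {x : X.Completion | x.1 C ∈ t} := by
  let _ : ∀ C : {C : AddSubgroup X.A // X.IsConstructible C}, TopologicalSpace (X.A ⧸ C.1) :=
    fun _ => ⊥
  have _ : ∀ C : {C : AddSubgroup X.A // X.IsConstructible C}, DiscreteTopology (X.A ⧸ C.1) :=
    fun _ => ⟨rfl⟩
  refine isOpen_induced_iff.2 ⟨{x | x C ∈ t}, ?_, rfl⟩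
  exact (isOpen_discrete t).preimage (continuous_apply C)

lemma exists_le_finset
    (I : Finset {C : AddSubgroup X.A // X.IsConstructible C}) :
    ∃ D : {C : AddSubgroup X.A // X.IsConstructible C}, ∀ C ∈ I, D.1 ≤ C.1 := by
  classical
  induction I using Finset.induction_on with
  | empty => exact ⟨⟨⊤, .top⟩, by simp⟩
  | insert C I _ ih =>
    obtain ⟨D, hD⟩ := ih
    refine ⟨⟨C.1 ⊓ D.1, C.2.inf X D.2⟩, fun E hE => ?_⟩
    rcases Finset.mem_insert.1 hE with rfl | hE
    · exact inf_le_left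
    · exact inf_le_right.trans (hD E hE)

lemma coord_eq_of_le {x y : X.Completion} {C D : {C : AddSubgroup X.A // X.IsConstructible C}}
    (h : C.1 ≤ D.1) (hxy : x.1 C = y.1 C) : x.1 D = y.1 D := by
  rw [← x.2 C D h, ← y.2 C D h, hxy]

lemma exists_coord_subset {U : Set X.Completion} (hU : IsOpen U) {x : X.Completion} (hx : x ∈ U) :
    ∃ C, ∀ y : X.Completion, y.1 C = x.1 C → y ∈ U := by
  let _ : ∀ C : {C : AddSubgroup X.A // X.IsConstructible C}, TopologicalSpace (X.A ⧸ C.1) :=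
    fun _ => ⊥
  obtain ⟨V, hV, rfl⟩ := isOpen_induced_iff.1 hU
  obtain ⟨I, u, hu, hI⟩ := isOpen_pi_iff.1 hV x.1 hx
  obtain ⟨D, hD⟩ := X.exists_le_finset I
  refine ⟨D, fun y hy => hI fun C hC => ?_⟩
  rw [X.coord_eq_of_le (hD C hC) hy]
  exact (hu C hC).2

lemma maps_iff (g : X.AffineGroup) (x y : X.Completion) :
    X.Maps g x y ↔ ∀ C, ∃ a b : X.A, X.affine g a = b ∧ x.1 C = (a : X.A ⧸ C.1) ∧
      y.1 C = (b : X.A ⧸ C.1) := by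
  constructor
  · intro h C
    obtain ⟨_, ⟨h1, h2⟩, a, b, hab, rfl⟩ := mem_closure_iff.1 h
      ({z : X.Completion | z.1 C ∈ ({x.1 C} : Set _)} ×ˢ
        {z : X.Completion | z.1 C ∈ ({y.1 C} : Set _)})
      ((X.isOpen_coord C _).prod (X.isOpen_coord C _)) ⟨rfl, rfl⟩
    exact ⟨a, b, hab, h1.symm, h2.symm⟩
  · intro h
    refine mem_closure_iff.2 fun O hO hxy => ?_
    obtain ⟨U, V, hU, hV, hx, hy, hUV⟩ := isOpen_prod_iff.1 hO x y hxy
    obtain ⟨C, hC⟩ := X.exists_coord_subset hU hx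
    obtain ⟨D, hD⟩ := X.exists_coord_subset hV hy
    obtain ⟨a, b, hab, ha, hb⟩ := h ⟨C.1 ⊓ D.1, C.2.inf X D.2⟩
    refine ⟨(X.toCompletion a, X.toCompletion b), hUV ⟨hC _ ?_, hD _ ?_⟩, a, b, hab, rfl⟩
    · exact X.coord_eq_of_le (C := ⟨C.1 ⊓ D.1, C.2.inf X D.2⟩) inf_le_left ha.symm
    · exact X.coord_eq_of_le (C := ⟨C.1 ⊓ D.1, C.2.inf X D.2⟩) inf_le_right hb.symm

/-- Equicontinuity: a coordinate of `g.x` is determined by one coordinate of `x`. -/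
lemma exists_modulus (g : X.AffineGroup) (C : {C : AddSubgroup X.A // X.IsConstructible C}) :
    ∃ D : {C : AddSubgroup X.A // X.IsConstructible C}, D.1 ≤ C.1 ∧
      ∀ a a' b : X.A, (a : X.A ⧸ D.1) = (a' : X.A ⧸ D.1) → X.affine g a = b →
        ∃ b' : X.A, X.affine g a' = b' ∧ (b : X.A ⧸ C.1) = (b' : X.A ⧸ C.1) := by
  obtain ⟨D, hD, h⟩ := X.exists_constructible (SemidirectProduct.right g) C.2
  refine ⟨⟨D ⊓ C.1, hD.inf X C.2⟩, inf_le_right, fun a a' b haa hab => ?_⟩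
  obtain ⟨c, hc, hac⟩ := h _ (QuotientAddGroup.eq.1 haa).1
  refine ⟨b + c, ?_, ?_⟩
  · have := X.affine_sub g (a' : M) a
    rw [hab] at this
    rw [AddSubgroup.coe_add, ← hac, ← sub_eq_iff_eq_add', this]
    congr 1
    simp [sub_eq_neg_add]
  · exact QuotientAddGroup.eq.2 (by simpa using hc)

lemma maps_coord {g : X.AffineGroup} {x x' y y' : X.Completion}
    {C D : {C : AddSubgroup X.A // X.IsConstructible C}}  (hDC : D.1 ≤ C.1)
    (hD : ∀ a a' b : X.A, (a : X.A ⧸ D.1) = (a' : X.A ⧸ D.1) → X.affine g a = b →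
        ∃ b' : X.A, X.affine g a' = b' ∧ (b : X.A ⧸ C.1) = (b' : X.A ⧸ C.1))
    (h : X.Maps g x y) (h' : X.Maps g x' y') (hxx : x.1 D = x'.1 D) : y.1 C = y'.1 C := by
  obtain ⟨a, b, hab, ha, hb⟩ := (X.maps_iff g x y).1 h D
  obtain ⟨a', b', hab', ha', hb'⟩ := (X.maps_iff g x' y').1 h' D
  obtain ⟨b'', hb'', hbb⟩ := hD a a' b (by rw [← ha, ← ha', hxx]) hab
  have : b'' = b' := Subtype.ext (hb''.symm.trans hab')
  subst this
  rw [← y.2 D C hDC, ← y'.2 D C hDC, hb, hb']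
  exact hbb

lemma Maps.unique {g : X.AffineGroup} {x y y' : X.Completion} (h : X.Maps g x y)
    (h' : X.Maps g x y') : y = y' := by
  refine Subtype.ext (funext fun C => ?_)
  obtain ⟨D, hDC, hD⟩ := X.exists_modulus g C
  exact X.maps_coord hDC hD h h' rfl

lemma maps_one (x : X.Completion) : X.Maps 1 x x := by
  refine (X.maps_iff _ _ _).2 fun C => ?_
  obtain ⟨a, ha⟩ := QuotientAddGroup.mk_surjective (x.1 C)
  exact ⟨a, a, X.affine_one a, ha.symm, ha.symm⟩

lemma Maps.inv {g : X.AffineGroup} {x y : X.Completion} (h : X.Maps g x y) :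
    X.Maps g⁻¹ y x := by
  refine (X.maps_iff _ _ _).2 fun C => ?_
  obtain ⟨a, b, hab, ha, hb⟩ := (X.maps_iff _ _ _).1 h C
  refine ⟨b, a, ?_, hb, ha⟩
  rw [← hab, ← affine_mul, inv_mul_cancel, affine_one]

lemma Maps.mul {g h : X.AffineGroup} {x y z : X.Completion} (hg : X.Maps g y z)
    (hh : X.Maps h x y) : X.Maps (g * h) x z := by
  refine (X.maps_iff _ _ _).2 fun C => ?_
  obtain ⟨D, hDC, hD⟩ := X.exists_modulus g C
  obtain ⟨a, b, hab, ha, hb⟩ := (X.maps_iff _ _ _).1 hh D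
  obtain ⟨b', c, hbc, hb', hc⟩ := (X.maps_iff _ _ _).1 hg D
  obtain ⟨c', hc', hcc⟩ := hD b' b c (by rw [← hb, ← hb']) hbc
  refine ⟨a, c', by rw [affine_mul, hab, hc'], ?_, ?_⟩
  · rw [← x.2 D C hDC, ha]
    rfl
  · rw [← z.2 D C hDC, hc, ← hcc]
    rfl

/-! ### The partial transformation groupoid -/

/-- The arrows of `(M ⋊ G) ⋉ Ā`: pairs `(g, x)` such that `x ∈ Ā` is in the domain of `g`. -/
def Arrow : Type u :=
  {p : X.AffineGroup × X.Completion // ∃ y, X.Maps p.1 p.2 y}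

/-- The topology on arrows is induced by the product topology (`M ⋊ G` being discrete). -/
instance : TopologicalSpace X.Arrow :=
  inferInstanceAs
    (TopologicalSpace {p : X.AffineGroup × X.Completion // ∃ y, X.Maps p.1 p.2 y})

variable {X} in
/-- The source `x` of the arrow `(g, x)`. -/
def Arrow.source (p : X.Arrow) : X.Completion := p.1.2

variable {X} in
/-- The range `g.x` of the arrow `(g, x)`. -/
def Arrow.range (p : X.Arrow) : X.Completion := p.2.choose

variable {X} in
lemma Arrow.maps (p : X.Arrow) : X.Maps p.1.1 p.source p.range := p.2.choose_spec

variable {X} in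
lemma Arrow.range_eq {p : X.Arrow} {y : X.Completion} (h : X.Maps p.1.1 p.source y) :
    p.range = y := Maps.unique X p.maps h

lemma Arrow.continuous_range : Continuous (Arrow.range : X.Arrow → X.Completion) := by
  rw [continuous_iff_continuousAt]
  intro p
  refine tendsto_nhds.2 fun U hU hp => ?_
  obtain ⟨C, hC⟩ := X.exists_coord_subset hU hp
  obtain ⟨D, hDC, hD⟩ := X.exists_modulus p.1.1 C
  have hopen : IsOpen {q : X.Arrow | q.1.1 ∈ ({p.1.1} : Set _) ∧
      q.1.2 ∈ {z : X.Completion | z.1 D ∈ ({p.1.2.1 D} : Set _)}} :=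
    ((isOpen_discrete _).preimage (continuous_fst.comp continuous_subtype_val)).inter
      ((X.isOpen_coord D _).preimage (continuous_snd.comp continuous_subtype_val))
  refine Filter.mem_of_superset (hopen.mem_nhds ⟨rfl, rfl⟩) ?_
  rintro q ⟨hq1, hq2⟩
  refine hC _ (X.maps_coord hDC hD ?_ p.maps hq2)
  have := q.maps
  rwa [show q.1.1 = p.1.1 from hq1] at this

variable {X} in
/-- The product `(g, h.x) (h, x) = (g h, x)` of arrows. -/
def Arrow.mul (p q : X.Arrow) (h : p.source = q.range) : X.Arrow :=
  ⟨(p.1.1 * q.1.1, q.1.2), p.range, Maps.mul X (h ▸ p.maps) q.maps⟩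

lemma Arrow.continuous_mul :
    Continuous fun pq : {pq : X.Arrow × X.Arrow // pq.1.source = pq.2.range} =>
      Arrow.mul pq.1.1 pq.1.2 pq.2 := by
  have h1 : Continuous fun p : X.Arrow => p.1.1 := continuous_fst.comp continuous_subtype_val
  have h2 : Continuous fun p : X.Arrow => p.1.2 := continuous_snd.comp continuous_subtype_val
  have k : Continuous
      fun pq : {pq : X.Arrow × X.Arrow // pq.1.source = pq.2.range} => (pq : X.Arrow × X.Arrow) :=
    continuous_subtype_val
  have k1 := h1.comp (continuous_fst.comp k)
  have k2 := h1.comp (continuous_snd.comp k)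
  have k3 := h2.comp (continuous_snd.comp k)
  have m : Continuous fun g : X.AffineGroup × X.AffineGroup => g.1 * g.2 :=
    continuous_of_discreteTopology
  exact ((m.comp (k1.prodMk k2)).prodMk k3).subtype_mk _

/-- The topological groupoid `(M ⋊ G) ⋉ Ā`, with product `(g, h.x) (h, x) = (g h, x)` and inverse
`(g, x)⁻¹ = (g⁻¹, g.x)`. -/
def groupoid : TopGroupoid.{u} where
  Obj := X.Completion
  Arr := X.Arrow
  source := Arrow.source
  range := Arrow.range
  unit x := ⟨(1, x), x, X.maps_one x⟩
  mul := Arrow.mul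
  inv p := ⟨(p.1.1⁻¹, p.range), p.source, p.maps.inv⟩
  source_unit _ := rfl
  range_unit x := Arrow.range_eq (X.maps_one x)
  source_mul _ _ _ := rfl
  range_mul p q h := Arrow.range_eq (Maps.mul X (h ▸ p.maps) q.maps)
  source_inv _ := rfl
  range_inv p := Arrow.range_eq p.maps.inv
  unit_mul _ := Subtype.ext (Prod.ext (one_mul _) rfl)
  mul_unit _ := Subtype.ext (Prod.ext (mul_one _) rfl)
  mul_assoc _ _ _ _ _ := Subtype.ext (Prod.ext (_root_.mul_assoc _ _ _) rfl)
  inv_mul _ := Subtype.ext (Prod.ext (inv_mul_cancel _) rfl)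
  mul_inv _ := Subtype.ext (Prod.ext (mul_inv_cancel _) rfl)
  continuous_source := continuous_snd.comp continuous_subtype_val
  continuous_range := Arrow.continuous_range X
  continuous_unit := (Continuous.prodMk continuous_const continuous_id).subtype_mk _
  continuous_inv := (Continuous.prodMk
    ((continuous_of_discreteTopology (f := fun g : X.AffineGroup => g⁻¹)).comp
      (continuous_fst.comp continuous_subtype_val)) (Arrow.continuous_range X)).subtype_mk _
  continuous_mul := Arrow.continuous_mul X

end GlobalizedAction

/-! ## Finite algebraic equivalence -/

/-- An algebraic embedding of an action `σ` of `G` on `M` into an action `τ` of `H` on `N`: an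
injective group homomorphism `t : G → H` and an injective group homomorphism `b : M → N` that is
equivariant along `t`. -/
structure AlgebraicEmbedding {G : Type*} {M : Type*} {H : Type*} {N : Type*} [Group G] [AddCommGroup M] [Group H]
    [AddCommGroup N] (σ : G →* Multiplicative (AddAut M)) (τ : H →* Multiplicative (AddAut N)) where
  t : G →* H
  b : M →+ N
  t_injective : Function.Injective t
  b_injective : Function.Injective b
  equivariant : ∀ g x, b ((σ g).toAdd x) = (τ (t g)).toAdd (b x)

/-- Finite algebraic equivalence: each action embeds into the other by an embedding `(t, b)` which
is strict (`t` is an isomorphism) and of finite index (the image of `b` has finite index). -/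
def FinitelyAlgebraicallyEquivalent {G : Type*} {M : Type*} {H : Type*} {N : Type*} [Group G] [AddCommGroup M]
    [Group H] [AddCommGroup N] (σ : G →* Multiplicative (AddAut M))
    (τ : H →* Multiplicative (AddAut N)) : Prop :=
  (∃ e : AlgebraicEmbedding σ τ, Function.Bijective e.t ∧ e.b.range.FiniteIndex) ∧
    ∃ e : AlgebraicEmbedding τ σ, Function.Bijective e.t ∧ e.b.range.FiniteIndex

/-! ## Arithmetic `S`-integer systems -/

namespace SIntegerSystem

variable (K : Type u) [Field K] [NumberField K] (S : Set (HeightOneSpectrum (𝓞 K)))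
  (ξ : 𝓞 K) (hξ : ξ ≠ 0)

/-- The ring `R_S[1/ξ]`, where `R_S` is the ring of `S`-integers of the number field `K`. -/
abbrev away : Subalgebra (S.integer K) K :=
  Algebra.adjoin (S.integer K) {(ξ : K)⁻¹}

/-- The element `ξ` as a unit of `R_S[1/ξ]`. -/
def unit : (away K S ξ)ˣ where
  val := algebraMap (S.integer K) (away K S ξ) (algebraMap (𝓞 K) (S.integer K) ξ)
  inv := ⟨(ξ : K)⁻¹, Algebra.self_mem_adjoin_singleton _ _⟩
  val_inv := Subtype.ext (mul_inv_cancel₀ (by simpa using hξ))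
  inv_val := Subtype.ext (inv_mul_cancel₀ (by simpa using hξ))

/-- The group `⟨ξ⟩` generated by `ξ` inside the unit group of `R_S[1/ξ]`. -/
abbrev zpowersXi : Subgroup (away K S ξ)ˣ := Subgroup.zpowers (unit K S ξ hξ)

/-- The globalized action of `⟨ξ⟩` on `R_S[1/ξ]` by multiplication, with submonoid
`{1, ξ, ξ², …}` and stable subgroup `R_S`. -/
def globalizedAction : GlobalizedAction (zpowersXi K S ξ hξ) (away K S ξ) where
  σ := (DistribMulAction.toAddAut (away K S ξ)ˣ (away K S ξ)).comp (Subgroup.subtype _)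
  S := Submonoid.powers ⟨unit K S ξ hξ, Subgroup.mem_zpowers _⟩
  A := (algebraMap (S.integer K) (away K S ξ)).toAddMonoidHom.range
  closure_S := by
    rw [eq_top_iff]
    rintro ⟨_, n, rfl⟩ _
    have : (⟨unit K S ξ hξ, Subgroup.mem_zpowers _⟩ : zpowersXi K S ξ hξ) ^ n ∈
        Subgroup.closure ((Submonoid.powers (⟨unit K S ξ hξ, Subgroup.mem_zpowers _⟩ :
          zpowersXi K S ξ hξ) : Submonoid _) : Set (zpowersXi K S ξ hξ)) :=
      Subgroup.zpow_mem _ (Subgroup.subset_closure (Submonoid.mem_powers _)) n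
    exact this
  stable := by
    rintro _ ⟨n, rfl⟩ _ ⟨r, rfl⟩
    refine ⟨(algebraMap (𝓞 K) (S.integer K) ξ) ^ n * r, ?_⟩
    change algebraMap (S.integer K) (away K S ξ) _ =
      ((unit K S ξ hξ ^ n : (away K S ξ)ˣ) : away K S ξ) * algebraMap (S.integer K) (away K S ξ) r
    rw [map_mul, map_pow, Units.val_pow_eq_pow_val]
    rfl

/-- The topological groupoid `(R_S[1/ξ] ⋊ ⟨ξ⟩) ⋉ R̄_S`. -/
def groupoid : TopGroupoid.{u} := (globalizedAction K S ξ hξ).groupoid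

/-- The `ℤ`-action on `R_S[1/ξ]` in which `n` acts as multiplication by `ξ ^ n`. -/
def intAction : Multiplicative ℤ →* Multiplicative (AddAut (away K S ξ)) :=
  (DistribMulAction.toAddAut (away K S ξ)ˣ (away K S ξ)).comp
    (zpowersHom (away K S ξ)ˣ (unit K S ξ hξ))

end SIntegerSystem

end

/-! An isomorphism `Φ` of the groupoids sends an arrow `(g, x)` to an arrow whose group component
`cocycle Φ g x` lies in the affine group of the other system. This is a locally constant cocycle,
and rigidity means that it is a homomorphism on small translations near a suitable point. Write `e`
for the action of the generator `t` on `A` and `s` for the generator of the other system.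

Two mechanisms carry this. First, for an abelian target, `exists_uniform_level` shows that the
cocycle on translations by `e ^ n A` is insensitive to moving the base point by `e ^ n A`, hence
additive near the base point. Although `A` need not be finitely generated, `A = B + e A` with `B`
finitely generated and `e`-invariant, and commutativity of `A` transfers the uniform level from `B`
to `A`. Secondly, if the base point is fixed by an affine map with linear part `t ^ j`, `j > 0`,
then an integer valued cocycle gives a homomorphism `F` with `F ∘ e ^ j = F`. Since `e ^ j - 1`
divides a non-zero integer, `F = 0` (`exists_level_eq_zero`).

Applied to the linear part of the cocycle, the second mechanism shows that small translations go to
translations; the first then yields an injective homomorphism `f` (`exists_local_hom`). Comparison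
with the arrow of `t` at `0` gives `f ∘ t = s ^ j ∘ f`, and the same analysis of `Φ.symm` shows that
the image of `f` is open (`exists_intertwiner`). A negative `j` would put the image of `f` into
every `s ^ n A`, which is impossible. Comparing indices for `Φ` and `Φ.symm` forces `j = 1`
(`index_eq_of_intertwiner`). Finally `f` extends along the union of the `t ^ (-n) A` to an
isomorphism of the globalizations (`exists_extension`), so the conclusion holds with the identity of
`ℤ` and a bijective `b`.

The arithmetic enters only through `IsArithmetic`, which `S`-integers satisfy by approximation, a
valuation with `v(ξ) < 1`, and the ideal norm. -/

noncomputable section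

/-! ## Almost periodic translation cocycles -/

section Cocycle

variable {A Γ : Type*} [AddCommGroup A] (e : AddMonoid.End A)

/-- `τ a` depends on its second argument only modulo the image of `e ^ n`. -/
def HasLevel (τ : A → A → Γ) (n : ℕ) (a : A) : Prop :=
  ∀ b c, τ a (b + (e ^ n) c) = τ a b

variable {e}

lemma end_pow_add_apply (m n : ℕ) (a : A) : (e ^ (m + n)) a = (e ^ m) ((e ^ n) a) := by
  rw [pow_add]
  rfl

lemma end_pow_succ_apply (n : ℕ) (a : A) : (e ^ (n + 1)) a = e ((e ^ n) a) := by
  rw [pow_succ']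
  rfl

lemma end_pow_succ_apply' (n : ℕ) (a : A) : (e ^ (n + 1)) a = (e ^ n) (e a) := by
  rw [pow_succ]
  rfl

lemma end_pow_mem {B : AddSubgroup A} (heB : B.map e ≤ B) (k : ℕ) {b : A} (hb : b ∈ B) :
    (e ^ k) b ∈ B := by
  induction k with
  | zero => exact hb
  | succ k ih =>
    rw [end_pow_succ_apply]
    exact heB ⟨_, ih, rfl⟩

lemma HasLevel.mono {τ : A → A → Γ} {m n : ℕ} (h : m ≤ n) {a : A} (ha : HasLevel e τ m a) :
    HasLevel e τ n a := by
  intro b c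
  obtain ⟨k, rfl⟩ := Nat.exists_eq_add_of_le h
  rw [end_pow_add_apply]
  exact ha _ _

variable [AddCommGroup Γ]

/-- By the cocycle identity the elements of a fixed level form a subgroup, so the largest level of
the generators serves. -/
lemma exists_hasLevel_of_fg {B : AddSubgroup A} (hB : B.FG) {τ : A → A → Γ}
    (hτ : ∀ a a' b, τ (a + a') b = τ a (a' + b) + τ a' b)
    (hper : ∀ a, ∃ n, HasLevel e τ n a) : ∃ n, ∀ a ∈ B, HasLevel e τ n a := by
  classical
  obtain ⟨s, rfl⟩ := hB
  choose n hn using hper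
  refine ⟨s.sup n, fun a ha => ?_⟩
  have h0 : ∀ b, τ 0 b = 0 := fun b => by simpa using hτ 0 0 b
  induction ha using AddSubgroup.closure_induction with
  | mem a ha => exact (hn a).mono (Finset.le_sup ha)
  | zero => intro b c; rw [h0, h0]
  | add a a' _ _ iha iha' =>
    intro b c
    rw [hτ, hτ, ← add_assoc, iha, iha']
  | neg a _ iha =>
    have key : ∀ b, τ (-a) b = - τ a (-a + b) := fun b => by
      have := hτ a (-a) b
      rw [add_neg_cancel, h0] at this
      exact (neg_eq_of_add_eq_zero_right this.symm).symm
    intro b c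
    rw [key, key, ← add_assoc, iha]

/-- Substitute `A = B + e A` into itself; invariance of `B` absorbs the new terms. -/
lemma sup_range_pow {B : AddSubgroup A} (heB : B.map e ≤ B)
    (hsup : B ⊔ AddMonoidHom.range e = ⊤) (n : ℕ) (a : A) :
    ∃ b ∈ B, ∃ c, a = b + (e ^ n) c := by
  induction n with
  | zero => exact ⟨0, B.zero_mem, a, by simp⟩
  | succ n ih =>
    obtain ⟨b, hb, c, rfl⟩ := ih
    obtain ⟨b', hb', _, ⟨d, rfl⟩, rfl⟩ := AddSubgroup.mem_sup.1 (hsup ▸ AddSubgroup.mem_top c)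
    refine ⟨b + (e ^ n) b', B.add_mem hb (end_pow_mem heB n hb'), d, ?_⟩
    rw [map_add, end_pow_succ_apply', add_assoc]
    rfl

/-- An almost periodic translation cocycle with values in an abelian group is, close to any base
point, a homomorphism. -/
lemma exists_uniform_level {B : AddSubgroup A} (hB : B.FG) (heB : B.map e ≤ B)
    (hsup : B ⊔ AddMonoidHom.range e = ⊤) {τ : A → A → Γ}
    (hτ : ∀ a a' b, τ (a + a') b = τ a (a' + b) + τ a' b)
    (hper : ∀ a, ∃ n, HasLevel e τ n a) : ∃ n, ∀ a, HasLevel e τ n ((e ^ n) a) := by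
  obtain ⟨n, hn⟩ := exists_hasLevel_of_fg hB hτ hper
  refine ⟨n, fun a b c => ?_⟩
  obtain ⟨m, hm⟩ := hper ((e ^ n) a)
  -- The level `m` depends on `a`, but it only serves to discard `d` and so to reduce from `c` to `β
  -- ∈ B`, where the uniform `n` applies.
  obtain ⟨β, hβ, d, rfl⟩ := sup_range_pow heB hsup m c
  rw [map_add, ← add_assoc, ← end_pow_add_apply, add_comm n m, end_pow_add_apply,
    hm]
  -- Expand `τ` at `e ^ n a + e ^ n β` in both orders. The two terms in `τ (e ^ n β)` agree because
  -- `e ^ n β ∈ B` has level `n`, and they cancel.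
  have h1 := hτ ((e ^ n) a) ((e ^ n) β) b
  rw [add_comm, hτ, add_comm ((e ^ n) a) b, hn _ (end_pow_mem heB n hβ),
    add_comm (τ ((e ^ n) β) b)] at h1
  rw [add_comm b]
  exact (add_right_cancel h1).symm

end Cocycle

/-! ### Arithmetic actions: cofinal levels, indices, compactness of the completion. -/

namespace GlobalizedAction

variable {G M : Type u} [Group G] [AddCommGroup M] (X : GlobalizedAction G M)

/-- The endomorphism of `A` given by `t ∈ S`, as an element of the endomorphism monoid. -/
def step (t : X.S) : AddMonoid.End X.A := X.endo t

/-- The properties of the arithmetic systems on which the rigidity argument rests: `S` is generated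
by one element `t` of `G`, whose endomorphism `e` of `A` is separating with finite non-trivial
cokernel covered by an `e`-invariant finitely generated subgroup, and each `e ^ j - 1` divides a
non-zero integer. -/
structure IsArithmetic (t : X.S) : Prop where
  eq_powers : X.S = Submonoid.powers (t : G)
  exists_mem (m : M) : ∃ n : ℕ, (X.σ ((t : G) ^ n)).toAdd m ∈ X.A
  finite_quotient : Finite (X.A ⧸ AddMonoidHom.range (X.step t))
  range_ne_top : AddMonoidHom.range (X.step t) ≠ ⊤
  separated (a : X.A) : (∀ n, a ∈ AddMonoidHom.range (X.step t ^ n)) → a = 0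
  exists_fg : ∃ B : AddSubgroup X.A, B.FG ∧ B.map (X.step t) ≤ B ∧
    B ⊔ AddMonoidHom.range (X.step t) = ⊤
  exists_int (j : ℕ) : 0 < j → ∃ N : ℤ, N ≠ 0 ∧ ∃ r : AddMonoid.End X.A,
    ∀ a, N • a = (X.step t ^ j) (r a) - r a

variable {X} {t : X.S}

lemma coe_step (a : X.A) : (X.step t a : M) = (X.σ t).toAdd a := rfl

lemma coe_step_pow (n : ℕ) (a : X.A) :
    ((X.step t ^ n) a : M) = (X.σ ((t : G) ^ n)).toAdd a := by
  induction n with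
  | zero => rw [pow_zero, pow_zero, map_one]; rfl
  | succ n ih =>
    rw [end_pow_succ_apply, coe_step, ih, pow_succ', map_mul]
    rfl

lemma step_pow_injective (n : ℕ) : Function.Injective (X.step t ^ n) := fun a b h =>
  Subtype.ext ((X.σ ((t : G) ^ n)).toAdd.injective (by rw [← coe_step_pow, ← coe_step_pow, h]))

lemma isConstructible_range_step_pow (t : X.S) (n : ℕ) :
    X.IsConstructible (AddMonoidHom.range (X.step t ^ n)) := by
  induction n with
  | zero =>
    convert IsConstructible.top
    exact (AddSubgroup.eq_top_iff' _).2 fun x => ⟨x, rfl⟩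
  | succ n ih =>
    convert IsConstructible.map t _ ih using 1
    ext x
    constructor
    · rintro ⟨y, rfl⟩
      exact ⟨_, ⟨y, rfl⟩, (end_pow_succ_apply n y).symm⟩
    · rintro ⟨_, ⟨y, rfl⟩, rfl⟩
      exact ⟨y, end_pow_succ_apply n y⟩

/-- The constructible subgroup `e ^ n A`. -/
def level (t : X.S) (n : ℕ) : {C : AddSubgroup X.A // X.IsConstructible C} :=
  ⟨AddMonoidHom.range (X.step t ^ n), isConstructible_range_step_pow t n⟩

lemma level_anti {m n : ℕ} (h : m ≤ n) : (level t n).1 ≤ (level t m).1 := by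
  obtain ⟨k, rfl⟩ := Nat.exists_eq_add_of_le h
  rintro _ ⟨y, rfl⟩
  exact ⟨_, (end_pow_add_apply m k y).symm⟩

lemma index_level (n : ℕ) :
    (level t n).1.index = (AddMonoidHom.range (X.step t)).index ^ n := by
  induction n with
  | zero =>
    rw [pow_zero, AddSubgroup.index_eq_one]
    exact (AddSubgroup.eq_top_iff' _).2 fun x => ⟨x, rfl⟩
  | succ n ih =>
    have h2 : ((AddMonoidHom.range (X.step t)).map (X.step t ^ n : AddMonoid.End X.A)).relIndex
        ((⊤ : AddSubgroup X.A).map (X.step t ^ n : AddMonoid.End X.A)) =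
        (AddMonoidHom.range (X.step t)).relIndex ⊤ :=
      AddSubgroup.relIndex_map_map_of_injective _ _ (step_pow_injective n)
    have h3 : (level t (n + 1)).1 =
        (AddMonoidHom.range (X.step t)).map (X.step t ^ n : AddMonoid.End X.A) := by
      ext x
      constructor
      · rintro ⟨y, rfl⟩
        exact ⟨_, ⟨y, rfl⟩, (end_pow_succ_apply' n y).symm⟩
      · rintro ⟨_, ⟨y, rfl⟩, rfl⟩
        exact ⟨y, end_pow_succ_apply' n y⟩
    have h4 : (level t n).1 = (⊤ : AddSubgroup X.A).map (X.step t ^ n : AddMonoid.End X.A) :=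
      AddMonoidHom.range_eq_map _
    rw [← h3, ← h4, AddSubgroup.relIndex_top_right] at h2
    rw [← AddSubgroup.relIndex_mul_index (level_anti (t := t) n.le_succ), h2, ih, pow_succ']

namespace IsArithmetic

variable (h : X.IsArithmetic t)
include h

/-- Every element of `S` acts as a power of `e`: images shift the level, and preimages only enlarge
since `e ^ n A` is invariant. Thus the levels are cofinal and describe the topology. -/
lemma exists_level_le (C : {C : AddSubgroup X.A // X.IsConstructible C}) :
    ∃ n, (level t n).1 ≤ C.1 := by
  obtain ⟨C, hC⟩ := C
  have key (s : X.S) : ∃ k, ∀ a, X.endo s a = (X.step t ^ k) a := by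
    obtain ⟨k, hk⟩ := (Submonoid.mem_powers_iff _ _).1 (h.eq_powers.le s.2)
    exact ⟨k, fun a => Subtype.ext (by rw [coe_step_pow, hk]; rfl)⟩
  induction hC with
  | top => exact ⟨0, le_top⟩
  | map s C _ ih =>
    obtain ⟨n, hn⟩ := ih
    obtain ⟨k, hk⟩ := key s
    refine ⟨k + n, ?_⟩
    rintro _ ⟨y, rfl⟩
    exact ⟨(X.step t ^ n) y, hn ⟨y, rfl⟩, by rw [hk]; exact (end_pow_add_apply k n y).symm⟩
  | comap s C _ ih =>
    obtain ⟨n, hn⟩ := ih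
    obtain ⟨k, hk⟩ := key s
    refine ⟨n, ?_⟩
    rintro _ ⟨y, rfl⟩
    rw [AddSubgroup.mem_comap, hk]
    refine hn ⟨(X.step t ^ k) y, ?_⟩
    exact (end_pow_add_apply n k y).symm.trans (by rw [add_comm]; exact end_pow_add_apply k n y)

lemma finiteIndex_level (n : ℕ) : (level t n).1.FiniteIndex := by
  have h1 : (AddMonoidHom.range (X.step t)).FiniteIndex :=
    have := h.finite_quotient
    AddSubgroup.finiteIndex_of_finite_quotient
  exact ⟨by rw [index_level]; exact pow_ne_zero _ h1.index_ne_zero⟩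

lemma finite_coord (C : {C : AddSubgroup X.A // X.IsConstructible C}) : Finite (X.A ⧸ C.1) := by
  obtain ⟨n, hn⟩ := h.exists_level_le C
  have := h.finiteIndex_level n
  have := AddSubgroup.finiteIndex_of_le hn
  exact AddSubgroup.finite_quotient_of_finiteIndex

lemma compactSpace : CompactSpace X.Completion := by
  let _ : ∀ C : {C : AddSubgroup X.A // X.IsConstructible C}, TopologicalSpace (X.A ⧸ C.1) :=
    fun _ => ⊥
  have _ : ∀ C : {C : AddSubgroup X.A // X.IsConstructible C}, DiscreteTopology (X.A ⧸ C.1) :=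
    fun _ => ⟨rfl⟩
  have _ := h.finite_coord
  have hclosed : IsClosed {x : (C : {C : AddSubgroup X.A // X.IsConstructible C}) → X.A ⧸ C.1 |
      ∀ C D (h : C.1 ≤ D.1),
        QuotientAddGroup.map C.1 D.1 (AddMonoidHom.id X.A) h (x C) = x D} := by
    simp only [Set.ofPred_forall]
    exact isClosed_iInter fun C => isClosed_iInter fun D => isClosed_iInter fun _ =>
      isClosed_eq (continuous_of_discreteTopology.comp (continuous_apply C)) (continuous_apply D)
  exact isCompact_iff_compactSpace.1 hclosed.isCompact

/-- A locally constant function on the completion is determined by a single coordinate. -/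
lemma exists_uniform_coord {D : Type*} {F : X.Completion → D}
    (hF : ∀ x, ∃ n, ∀ y : X.Completion, y.1 (level t n) = x.1 (level t n) → F y = F x) :
    ∃ n, ∀ x y : X.Completion, y.1 (level t n) = x.1 (level t n) → F y = F x := by
  classical
  have := h.compactSpace
  choose n hn using hF
  obtain ⟨s, hs⟩ := isCompact_univ.elim_finite_subcover
    (fun x : X.Completion =>
      {y : X.Completion | y.1 (level t (n x)) ∈ ({x.1 (level t (n x))} : Set _)})
    (fun x => X.isOpen_coord _ _) (fun x _ => Set.mem_iUnion.2 ⟨x, rfl⟩)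
  refine ⟨s.sup n, fun x y hxy => ?_⟩
  obtain ⟨z, hz, hxz⟩ := Set.mem_iUnion₂.1 (hs (Set.mem_univ x))
  rw [hn z x hxz, hn z y]
  rw [← hxz]
  exact X.coord_eq_of_le (level_anti (Finset.le_sup hz)) hxy

/-- The modulus of continuity at `p` of a function on arrows with discrete values. -/
lemma exists_level_arrow {D : Type*} [TopologicalSpace D] [DiscreteTopology D] {F : X.Arrow → D}
    (hF : Continuous F) (p : X.Arrow) : ∃ n, ∀ q : X.Arrow, q.1.1 = p.1.1 →
      q.1.2.1 (level t n) = p.1.2.1 (level t n) → F q = F p := by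
  have hopen : IsOpen (F ⁻¹' {F p}) := (isOpen_discrete _).preimage hF
  obtain ⟨V, hV, hVF⟩ := isOpen_induced_iff.1 hopen
  have hp : (p.1.1, p.1.2) ∈ V := by
    have : p ∈ F ⁻¹' {F p} := rfl
    rwa [← hVF] at this
  obtain ⟨U, W, _, hW, hpU, hpW, hUW⟩ := isOpen_prod_iff.1 hV _ _ hp
  obtain ⟨C, hC⟩ := X.exists_coord_subset hW hpW
  obtain ⟨n, hn⟩ := h.exists_level_le C
  refine ⟨n, fun q hq hqp => ?_⟩
  have : q ∈ F ⁻¹' {F p} := by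
    rw [← hVF]
    exact hUW ⟨hq ▸ hpU, hC _ (X.coord_eq_of_le hn hqp)⟩
  exact this

/-- The modulus of continuity at `x` of a continuous map between completions. -/
lemma exists_level_map {H N : Type v} [Group H] [AddCommGroup N] {Y : GlobalizedAction H N}
    {φ : X.Completion → Y.Completion} (hφ : Continuous φ) (x : X.Completion)
    (C : {C : AddSubgroup Y.A // Y.IsConstructible C}) :
    ∃ n, ∀ y : X.Completion, y.1 (level t n) = x.1 (level t n) → (φ y).1 C = (φ x).1 C := by
  obtain ⟨D, hD⟩ := X.exists_coord_subset ((Y.isOpen_coord C {(φ x).1 C}).preimage hφ) (x := x) rfl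
  obtain ⟨n, hn⟩ := h.exists_level_le D
  exact ⟨n, fun y hy => hD y (X.coord_eq_of_le hn hy)⟩

end IsArithmetic

/-! ### Translations -/

/-- Translation of the completion by an element of `A`. -/
def translate (a : X.A) (x : X.Completion) : X.Completion :=
  ⟨fun C => (a : X.A ⧸ C.1) + x.1 C, fun C D hCD => by
    rw [map_add, x.2 C D hCD]
    rfl⟩

/-- The element `(z, 1)` of the affine group. -/
def translation (X : GlobalizedAction G M) (z : M) : X.AffineGroup :=
  SemidirectProduct.inl (Multiplicative.ofAdd z)

lemma translate_add (a b : X.A) (x : X.Completion) :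
    translate (a + b) x = translate a (translate b x) :=
  Subtype.ext (funext fun C => add_assoc (a : X.A ⧸ C.1) (b : X.A ⧸ C.1) (x.1 C))

lemma translate_zero (x : X.Completion) : translate 0 x = x :=
  Subtype.ext (funext fun C => zero_add (x.1 C))

lemma translate_coord {n : ℕ} {a b : X.A} (hab : a - b ∈ (level t n).1) (x : X.Completion) :
    (translate a x).1 (level t n) = (translate b x).1 (level t n) := by
  change (a : X.A ⧸ (level t n).1) + _ = (b : X.A ⧸ (level t n).1) + _
  rw [(QuotientAddGroup.eq_iff_sub_mem).2 hab]

lemma translate_coord' {n : ℕ} {a : X.A} (ha : a ∈ (level t n).1) (x : X.Completion) :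
    (translate a x).1 (level t n) = x.1 (level t n) := by
  conv_rhs => rw [← translate_zero x]
  exact translate_coord (by rwa [sub_zero]) x

lemma translation_add (z w : M) :
    X.translation (z + w) = X.translation z * X.translation w := by
  unfold translation
  rw [ofAdd_add]
  exact map_mul SemidirectProduct.inl _ _

lemma translation_zero : X.translation 0 = 1 := rfl

lemma translation_injective : Function.Injective X.translation := fun _ _ hzw =>
  Multiplicative.ofAdd.injective (SemidirectProduct.inl_injective hzw)

lemma affine_translation (z x : M) : X.affine (X.translation z) x = z + x := by
  change z + (X.σ 1).toAdd x = z + x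
  rw [map_one]
  rfl

/-- The projection of the affine group to `G`. -/
def linearPart (X : GlobalizedAction G M) : X.AffineGroup →* G := SemidirectProduct.rightHom

lemma eq_translation {g : X.AffineGroup} (hg : X.linearPart g = 1) :
    g = X.translation (Multiplicative.toAdd (SemidirectProduct.left g)) :=
  SemidirectProduct.ext rfl hg

lemma mul_translation (g : X.AffineGroup) (z : M) :
    g * X.translation z = X.translation ((X.σ (X.linearPart g)).toAdd z) * g := by
  refine SemidirectProduct.ext ?_ ?_
  · change (SemidirectProduct.left g).toAdd + (X.σ (SemidirectProduct.right g)).toAdd z =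
      (X.σ (SemidirectProduct.right g)).toAdd z + (X.σ 1).toAdd (SemidirectProduct.left g).toAdd
    rw [map_one, add_comm]
    rfl
  · change SemidirectProduct.right g * 1 = 1 * SemidirectProduct.right g
    rw [mul_one, one_mul]

lemma maps_translate (a : X.A) (x : X.Completion) :
    X.Maps (X.translation a) x (translate a x) := by
  refine (X.maps_iff _ _ _).2 fun C => ?_
  obtain ⟨b, hb⟩ := QuotientAddGroup.mk_surjective (x.1 C)
  exact ⟨b, a + b, affine_translation _ _, hb.symm, by
    change (a : X.A ⧸ C.1) + x.1 C = _
    rw [← hb]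
    rfl⟩

/-- An affine map which fixes `x` acts linearly in the coordinate centred at `x`. -/
lemma Maps.translate {g : X.AffineGroup} {x y : X.Completion} (hg : X.Maps g x y) {a b : X.A}
    (hab : (X.σ (X.linearPart g)).toAdd (a : M) = b) :
    X.Maps g (translate a x) (GlobalizedAction.translate b y) := by
  have h1 := Maps.mul X (Maps.mul X (maps_translate b y) hg) (Maps.inv X (maps_translate a x))
  rwa [← hab, ← mul_translation, mul_inv_cancel_right] at h1

/-- Approximating the arrow at level `n` exhibits `z` as a difference of two elements of `A` that
represent the coordinates of `y` and `x`. For `n = 0` the coordinate condition is void and the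
result is `z ∈ A`. -/
lemma IsArithmetic.mem_of_maps_translation (n : ℕ) {z : M} {x y : X.Completion}
    (hz : X.Maps (X.translation z) x y) (hxy : y.1 (level t n) = x.1 (level t n)) :
    ∃ a ∈ (level t n).1, (a : M) = z := by
  obtain ⟨a, b, hab, ha, hb⟩ := (X.maps_iff _ _ _).1 hz (level t n)
  refine ⟨b - a, (QuotientAddGroup.eq_iff_sub_mem).1 (by rw [← ha, ← hb, hxy]), ?_⟩
  rw [affine_translation] at hab
  rw [AddSubgroup.coe_sub, ← hab, add_sub_cancel_right]

end GlobalizedAction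

/-- The inverse of an isomorphism of topological groupoids. -/
def TopGroupoid.Iso.symm {𝒢 : TopGroupoid.{u}} {ℋ : TopGroupoid.{v}} (Φ : TopGroupoid.Iso 𝒢 ℋ) :
    TopGroupoid.Iso ℋ 𝒢 where
  obj := Φ.obj.symm
  arr := Φ.arr.symm
  source_arr p := by
    rw [Homeomorph.eq_symm_apply, ← Φ.source_arr, Φ.arr.apply_symm_apply]
  range_arr p := by
    rw [Homeomorph.eq_symm_apply, ← Φ.range_arr, Φ.arr.apply_symm_apply]
  map_mul p q h := by
    rw [Homeomorph.symm_apply_eq, Φ.map_mul]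
    congr 1 <;> exact (Φ.arr.apply_symm_apply _).symm

/-! ### Integer valued cocycles near a point with isotropy. -/

namespace GlobalizedAction

variable {G M : Type u} [Group G] [AddCommGroup M] {X : GlobalizedAction G M} {t : X.S}

lemma coord_zero_eq (x y : X.Completion) : y.1 (level t 0) = x.1 (level t 0) := by
  obtain ⟨a, ha⟩ := QuotientAddGroup.mk_surjective (x.1 (level t 0))
  obtain ⟨b, hb⟩ := QuotientAddGroup.mk_surjective (y.1 (level t 0))
  rw [← ha, ← hb]
  exact QuotientAddGroup.eq_iff_sub_mem.2 ⟨b - a, rfl⟩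

lemma end_pow_comm {A : Type*} [AddCommGroup A] (e : AddMonoid.End A) (m n : ℕ) (a : A) :
    (e ^ m) ((e ^ n) a) = (e ^ n) ((e ^ m) a) := by
  rw [← end_pow_add_apply, add_comm, end_pow_add_apply]

namespace IsArithmetic

variable (h : X.IsArithmetic t)
include h

lemma pow_ne_one {n : ℕ} (hn : 0 < n) : (t : G) ^ n ≠ 1 := by
  intro h1
  refine h.range_ne_top ((AddSubgroup.eq_top_iff' _).2 fun a => ?_)
  obtain ⟨k, rfl⟩ := Nat.exists_eq_succ_of_ne_zero hn.ne'
  refine ⟨(X.step t ^ k) a, ?_⟩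
  refine (end_pow_succ_apply k a).symm.trans (Subtype.ext ?_)
  rw [coe_step_pow, h1, map_one]
  rfl

/-- The group `G` is infinite cyclic with generator `t`. -/
lemma exists_exponent : ∃ κ : G →* Multiplicative ℤ, ∀ g, (t : G) ^ (κ g).toAdd = g := by
  have hbij : Function.Bijective (zpowersHom G (t : G)) := by
    constructor
    · refine (injective_iff_map_eq_one _).2 fun n hn => ?_
      rw [zpowersHom_apply] at hn
      have h1 : (t : G) ^ (n.toAdd.natAbs) = 1 := by
        rcases Int.natAbs_eq n.toAdd with h2 | h2
        · rwa [h2, zpow_natCast] at hn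
        · rwa [h2, zpow_neg, inv_eq_one, zpow_natCast] at hn
      by_contra hne
      exact h.pow_ne_one (Int.natAbs_pos.2 fun h0 => hne (Multiplicative.toAdd.injective h0)) h1
    · intro g
      have hg : g ∈ Subgroup.zpowers (t : G) := by
        have h1 : Subgroup.closure (X.S : Set G) ≤ Subgroup.zpowers (t : G) := by
          rw [Subgroup.closure_le]
          intro g hg
          obtain ⟨n, rfl⟩ := h.eq_powers.le hg
          exact ⟨n, zpow_natCast _ _⟩
        exact h1 (X.closure_S ▸ Subgroup.mem_top g)
      obtain ⟨n, rfl⟩ := hg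
      exact ⟨Multiplicative.ofAdd n, rfl⟩
  refine ⟨(MulEquiv.ofBijective _ hbij).symm, fun g => ?_⟩
  exact (MulEquiv.ofBijective _ hbij).apply_symm_apply g

/-- A translation is defined on the whole compact completion, so the local moduli of constancy have
a common bound. -/
lemma exists_level_translation {D : Type*} {c : X.AffineGroup → X.Completion → D}
    (hloc : ∀ g x y, X.Maps g x y → ∃ n, ∀ x' y', X.Maps g x' y' →
      x'.1 (level t n) = x.1 (level t n) → c g x' = c g x) (x₀ : X.Completion) (a : X.A) :
    ∃ n, HasLevel (X.step t)
      (fun a b : X.A => c (X.translation a) (GlobalizedAction.translate b x₀)) n a := by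
  obtain ⟨n, hn⟩ := h.exists_uniform_coord (F := c (X.translation a)) fun x =>
    (hloc _ x _ (maps_translate a x)).imp fun n hn y hy => hn y _ (maps_translate a y) hy
  exact ⟨n, fun b d => hn _ _ (translate_coord ⟨d, by rw [add_sub_cancel_left]; rfl⟩ _)⟩

/-- An integer valued cocycle vanishes on small translations close to a base point with
sufficiently large isotropy. -/
lemma exists_level_eq_zero {c : X.AffineGroup → X.Completion → ℤ}
    (hmul : ∀ {g k x y z}, X.Maps g y z → X.Maps k x y → c (g * k) x = c g y + c k x)
    (hloc : ∀ g x y, X.Maps g x y → ∃ n, ∀ x' y', X.Maps g x' y' →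
      x'.1 (level t n) = x.1 (level t n) → c g x' = c g x)
    {x₀ : X.Completion} {g₀ : X.AffineGroup} (hg₀ : X.Maps g₀ x₀ x₀) {j : ℕ} (hj : 0 < j)
    (hlin : X.linearPart g₀ = (t : G) ^ j) :
    ∃ n, ∀ a b, c (X.translation ((X.step t ^ n) a : X.A))
      (GlobalizedAction.translate ((X.step t ^ n) b) x₀) = 0 := by
  obtain ⟨B, hB, heB, hsup⟩ := h.exists_fg
  obtain ⟨N, hN, r, hNr⟩ := h.exists_int j hj
  obtain ⟨n, hn⟩ := exists_uniform_level hB heB hsup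
    (τ := fun a b : X.A => c (X.translation a) (GlobalizedAction.translate b x₀))
    (fun a a' b => by
      rw [AddSubgroup.coe_add, translation_add, translate_add]
      exact hmul (maps_translate _ _) (maps_translate _ _))
    (h.exists_level_translation hloc x₀)
  obtain ⟨m, hm⟩ := hloc g₀ x₀ x₀ hg₀
  have hg₀b (b : X.A) : X.Maps g₀ (GlobalizedAction.translate b x₀)
      (GlobalizedAction.translate ((X.step t ^ j) b) x₀) :=
    hg₀.translate (by rw [hlin, coe_step_pow])
  have hconst (b : X.A) (hb : b ∈ (level t m).1) :
      c g₀ (GlobalizedAction.translate b x₀) = c g₀ x₀ :=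
    hm _ _ (hg₀b b) (translate_coord' hb x₀)
  -- Evaluate `c` on both sides of `g₀ · a = (e ^ j a) · g₀`. Both values of `c g₀` are taken within
  -- the radius `m` of constancy, so they cancel.
  have hinv (a b : X.A) (ha : a ∈ (level t m).1) (hb : b ∈ (level t m).1) :
      c (X.translation ((X.step t ^ j) a : X.A))
        (GlobalizedAction.translate ((X.step t ^ j) b) x₀) =
      c (X.translation a) (GlobalizedAction.translate b x₀) := by
    have h1 := hmul (maps_translate ((X.step t ^ j) a) _) (hg₀b b)
    have h2 := hmul (hg₀b (a + b)) (translate_add a b x₀ ▸ maps_translate a _)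
    rw [mul_translation, hlin, ← coe_step_pow, h1, hconst b hb,
      hconst _ (add_mem ha hb)] at h2
    linarith
  -- In the exponent, `n` makes the value independent of the nearby base point, which gives
  -- additivity, and `m` makes `hinv` applicable.
  let F : X.A →+ ℤ :=
    { toFun := fun a => c (X.translation ((X.step t ^ (n + m)) a : X.A)) x₀
      map_zero' := by
        have h1 := hmul (X.maps_one x₀) (X.maps_one x₀)
        rw [mul_one] at h1
        rw [map_zero, AddSubgroup.coe_zero, translation_zero]
        linarith
      map_add' := fun a a' => by
        have h1 := hmul (maps_translate ((X.step t ^ (n + m)) a) _)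
          (maps_translate ((X.step t ^ (n + m)) a') x₀)
        have h2 := hn ((X.step t ^ m) a) 0 ((X.step t ^ m) a')
        rw [zero_add, ← end_pow_add_apply, ← end_pow_add_apply] at h2
        beta_reduce at h2
        rw [translate_zero] at h2
        rw [map_add, AddSubgroup.coe_add, translation_add, h1, h2] }
  have hF (a b : X.A) : c (X.translation ((X.step t ^ (n + m)) a : X.A))
      (GlobalizedAction.translate ((X.step t ^ (n + m)) b) x₀) = F a := by
    have h2 := hn ((X.step t ^ m) a) 0 ((X.step t ^ m) b)
    rw [zero_add, ← end_pow_add_apply, ← end_pow_add_apply] at h2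
    beta_reduce at h2
    rw [translate_zero] at h2
    exact h2
  have hFinv (a : X.A) : F ((X.step t ^ j) a) = F a := by
    have h1 := hinv ((X.step t ^ (n + m)) a) 0
      (level_anti (Nat.le_add_left m n) ⟨a, rfl⟩) (zero_mem _)
    rw [map_zero, translate_zero, end_pow_comm] at h1
    exact h1
  refine ⟨n + m, fun a b => ?_⟩
  rw [hF]
  -- `N = (e ^ j - 1) r`, and `F` vanishes on the image of `e ^ j - 1`.
  have h1 : N • F a = 0 := by
    rw [← map_zsmul, hNr, map_sub, hFinv, sub_self]
  simpa [hN] using h1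

end IsArithmetic

/-! ### The cocycle of an isomorphism of groupoids -/

variable {H N : Type v} [Group H] [AddCommGroup N] {Y : GlobalizedAction H N} {s : Y.S}

open Classical in
/-- The cocycle with values in the affine group of `Y` that is determined by an isomorphism of
groupoids. -/
def cocycle (Φ : TopGroupoid.Iso X.groupoid Y.groupoid) (g : X.AffineGroup) (x : X.Completion) :
    Y.AffineGroup :=
  if h : ∃ y, X.Maps g x y then (Φ.arr (⟨(g, x), h⟩ : X.Arrow) : Y.Arrow).1.1 else 1

/-- The homeomorphism of unit spaces of an isomorphism of groupoids. -/
def base (Φ : TopGroupoid.Iso X.groupoid Y.groupoid) : X.Completion ≃ₜ Y.Completion := Φ.obj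

section

variable (Φ : TopGroupoid.Iso X.groupoid Y.groupoid) {g k : X.AffineGroup} {x y z : X.Completion}

lemma cocycle_eq (hg : X.Maps g x y) :
    cocycle Φ g x = (Φ.arr (⟨(g, x), y, hg⟩ : X.Arrow) : Y.Arrow).1.1 :=
  dif_pos _

lemma maps_cocycle (hg : X.Maps g x y) : Y.Maps (cocycle Φ g x) (base Φ x) (base Φ y) := by
  rw [cocycle_eq Φ hg]
  have h1 := Arrow.maps (Φ.arr (⟨(g, x), y, hg⟩ : X.Arrow) : Y.Arrow)
  have h2 : Arrow.source (Φ.arr (⟨(g, x), y, hg⟩ : X.Arrow) : Y.Arrow) = base Φ x :=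
    Φ.source_arr _
  have h3 : Arrow.range (Φ.arr (⟨(g, x), y, hg⟩ : X.Arrow) : Y.Arrow) = base Φ y :=
    (Φ.range_arr _).trans (congrArg Φ.obj (Arrow.range_eq hg))
  rwa [h2, h3] at h1

lemma arr_eq (hg : X.Maps g x y) : (Φ.arr (⟨(g, x), y, hg⟩ : X.Arrow) : Y.Arrow) =
    ⟨(cocycle Φ g x, base Φ x), base Φ y, maps_cocycle Φ hg⟩ :=
  Subtype.ext (Prod.ext (cocycle_eq Φ hg).symm (Φ.source_arr _))

lemma cocycle_mul (hg : X.Maps g y z) (hk : X.Maps k x y) :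
    cocycle Φ (g * k) x = cocycle Φ g y * cocycle Φ k x := by
  rw [cocycle_eq Φ hg, cocycle_eq Φ hk, cocycle_eq Φ (Maps.mul X hg hk)]
  have h1 := Φ.map_mul (⟨(g, y), z, hg⟩ : X.Arrow) (⟨(k, x), y, hk⟩ : X.Arrow)
    (Arrow.range_eq (p := ⟨(k, x), y, hk⟩) hk).symm
  exact congrArg (fun p : Y.Arrow => p.1.1) h1

lemma cocycle_one (x : X.Completion) : cocycle Φ 1 x = 1 := by
  have h1 := cocycle_mul Φ (X.maps_one x) (X.maps_one x)
  rwa [mul_one, left_eq_mul] at h1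

lemma base_symm_base (x : X.Completion) : base Φ.symm (base Φ x) = x :=
  Φ.obj.symm_apply_apply x

/-- `Φ.symm` undoes `Φ` on arrows, so the group element can be recovered from its cocycle value.
Injectivity and openness of the local homomorphism both come from this. -/
lemma cocycle_symm (hg : X.Maps g x y) : cocycle Φ.symm (cocycle Φ g x) (base Φ x) = g := by
  rw [cocycle_eq Φ.symm (maps_cocycle Φ hg), ← arr_eq Φ hg]
  exact congrArg (fun p : X.Arrow => p.1.1) (Φ.arr.symm_apply_apply _)

lemma exists_level_cocycle (h : X.IsArithmetic t) (g : X.AffineGroup) (x y : X.Completion)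
    (hg : X.Maps g x y) : ∃ n, ∀ x' y', X.Maps g x' y' →
      x'.1 (level t n) = x.1 (level t n) → cocycle Φ g x' = cocycle Φ g x := by
  have hF : Continuous fun p : X.Arrow => (Φ.arr p : Y.Arrow).1.1 :=
    (continuous_fst.comp continuous_subtype_val).comp Φ.arr.continuous
  obtain ⟨n, hn⟩ := h.exists_level_arrow hF ⟨(g, x), y, hg⟩
  refine ⟨n, fun x' y' hg' hx => ?_⟩
  rw [cocycle_eq Φ hg, cocycle_eq Φ hg']
  exact hn ⟨(g, x'), y', hg'⟩ rfl hx

end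

end GlobalizedAction

/-! ### The local homomorphism of an isomorphism and its intertwining property. -/

namespace GlobalizedAction

variable {G M : Type u} [Group G] [AddCommGroup M] {X : GlobalizedAction G M} {t : X.S}
  {H N : Type v} [Group H] [AddCommGroup N] {Y : GlobalizedAction H N} {s : Y.S}

/-- Close to a base point with sufficiently large isotropy, the cocycle of an isomorphism takes
translations to translations. -/
lemma exists_level_linearPart_cocycle (Φ : TopGroupoid.Iso X.groupoid Y.groupoid)
    (hX : X.IsArithmetic t) (hY : Y.IsArithmetic s)
    {x₀ : X.Completion} {g₀ : X.AffineGroup} (hg₀ : X.Maps g₀ x₀ x₀) {j : ℕ} (hj : 0 < j)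
    (hlin : X.linearPart g₀ = (t : G) ^ j) :
    ∃ n, ∀ a b, Y.linearPart (cocycle Φ (X.translation ((X.step t ^ n) a : X.A))
      (translate ((X.step t ^ n) b) x₀)) = 1 := by
  obtain ⟨κ, hκ⟩ := hY.exists_exponent
  obtain ⟨n, hn⟩ := hX.exists_level_eq_zero
    (c := fun g x => (κ (Y.linearPart (cocycle Φ g x))).toAdd)
    (fun hg hk => by
      rw [cocycle_mul Φ hg hk, map_mul, map_mul, toAdd_mul])
    (fun g x y hg => (exists_level_cocycle Φ hX g x y hg).imp fun n hn x' y' hg' hx => by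
      rw [hn x' y' hg' hx]) hg₀ hj hlin
  refine ⟨n, fun a b => ?_⟩
  have := hn a b
  rw [← hκ (Y.linearPart _), this, zpow_zero]

/-- Close to a base point with sufficiently large isotropy, the cocycle of an isomorphism is given
by an injective homomorphism. -/
lemma exists_local_hom (Φ : TopGroupoid.Iso X.groupoid Y.groupoid)
    (hX : X.IsArithmetic t) (hY : Y.IsArithmetic s)
    {x₀ : X.Completion} {g₀ : X.AffineGroup} (hg₀ : X.Maps g₀ x₀ x₀) {j : ℕ} (hj : 0 < j)
    (hlin : X.linearPart g₀ = (t : G) ^ j) :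
    ∃ n, ∃ f : X.A →+ Y.A, Function.Injective f ∧ ∀ a b,
      cocycle Φ (X.translation ((X.step t ^ n) a : X.A)) (translate ((X.step t ^ n) b) x₀) =
        Y.translation (f a) := by
  obtain ⟨B, hB, heB, hsup⟩ := hX.exists_fg
  obtain ⟨n, hn⟩ := exists_level_linearPart_cocycle Φ hX hY hg₀ hj hlin
  have hex (a b : X.A) : ∃ z : Y.A, cocycle Φ (X.translation ((X.step t ^ n) a : X.A))
      (translate ((X.step t ^ n) b) x₀) = Y.translation z := by
    have h1 := eq_translation (X := Y) (hn a b)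
    have h2 := maps_cocycle Φ (maps_translate ((X.step t ^ n) a) (translate ((X.step t ^ n) b) x₀))
    rw [h1] at h2
    obtain ⟨z, -, hz⟩ := IsArithmetic.mem_of_maps_translation (t := s) 0 h2 (coord_zero_eq _ _)
    exact ⟨z, by rw [hz]; exact h1⟩
  choose τ hτ using hex
  have hadd (a a' b : X.A) : τ (a + a') b = τ a (a' + b) + τ a' b := by
    refine Subtype.ext (translation_injective (X := Y) ?_)
    rw [AddSubgroup.coe_add, translation_add, ← hτ, ← hτ, ← hτ, map_add, AddSubgroup.coe_add,
      translation_add, cocycle_mul Φ (maps_translate _ _) (maps_translate _ _), ← translate_add,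
      ← map_add]
  have hper (a : X.A) : ∃ m, HasLevel (X.step t) τ m a := by
    obtain ⟨m, hm⟩ := hX.exists_level_translation (exists_level_cocycle Φ hX) x₀
      ((X.step t ^ n) a)
    refine ⟨m, fun b c => Subtype.ext (translation_injective (X := Y) ?_)⟩
    rw [← hτ, ← hτ, map_add, end_pow_comm]
    exact hm _ _
  obtain ⟨m, hm⟩ := exists_uniform_level hB heB hsup hadd hper
  have hm' (a b : X.A) : τ ((X.step t ^ m) a) ((X.step t ^ m) b) = τ ((X.step t ^ m) a) 0 := by
    have := hm a 0 b
    rwa [zero_add] at this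
  refine ⟨n + m, AddMonoidHom.mk' (fun a => τ ((X.step t ^ m) a) 0) fun a a' => ?_, ?_, ?_⟩
  · rw [map_add, hadd, add_zero, hm']
  · refine (injective_iff_map_eq_zero _).2 fun a ha => ?_
    have ha' : τ ((X.step t ^ m) a) 0 = 0 := ha
    have h1 := hτ ((X.step t ^ m) a) 0
    rw [ha', AddSubgroup.coe_zero, translation_zero] at h1
    -- If `f a = 0`, the arrow goes to a unit, and applying `Φ.symm` shows that the translation by
    -- `e ^ (n + m) a` is trivial.
    have h2 := cocycle_symm Φ (maps_translate ((X.step t ^ n) ((X.step t ^ m) a))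
      (translate ((X.step t ^ n) 0) x₀))
    rw [h1, cocycle_one, ← translation_zero] at h2
    have h7 := (translation_injective h2).symm
    rw [← end_pow_add_apply] at h7
    exact (step_pow_injective (t := t) (n + m)) ((Subtype.ext h7).trans (map_zero _).symm)
  · intro a b
    rw [end_pow_add_apply, end_pow_add_apply, hτ, hm']
    rfl

/-- An isomorphism of groupoids yields an injective homomorphism `f` with open image that
intertwines `t` with a power of `s`. -/
lemma exists_intertwiner (Φ : TopGroupoid.Iso X.groupoid Y.groupoid)
    (hX : X.IsArithmetic t) (hY : Y.IsArithmetic s) :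
    ∃ (j : ℤ) (f : X.A →+ Y.A), Function.Injective f ∧ (∃ l, (level s l).1 ≤ f.range) ∧
      ∀ a, (f (X.step t a) : N) = (Y.σ ((s : H) ^ j)).toAdd (f a) := by
  let g₀ : X.AffineGroup := SemidirectProduct.inr (t : G)
  let x₀ : X.Completion := X.toCompletion 0
  have hlin : X.linearPart g₀ = (t : G) := rfl
  have hg₀ : X.Maps g₀ x₀ x₀ := by
    refine (X.maps_iff _ _ _).2 fun C => ⟨0, 0, ?_, rfl, rfl⟩
    change (0 : M) + (X.σ (t : G)).toAdd 0 = 0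
    rw [map_zero, add_zero]
  obtain ⟨n, f, hf, hfc⟩ := exists_local_hom Φ hX hY hg₀ one_pos (hlin.trans (pow_one _).symm)
  obtain ⟨κ, hκ⟩ := hY.exists_exponent
  obtain ⟨j, hj⟩ : ∃ j : ℤ, (s : H) ^ j = Y.linearPart (cocycle Φ g₀ x₀) := ⟨_, hκ _⟩
  have hmg₀ (b : X.A) : X.Maps g₀ (translate b x₀) (translate (X.step t b) x₀) :=
    hg₀.translate (by rw [hlin, coe_step])
  obtain ⟨m, hm⟩ := exists_level_cocycle Φ hX g₀ x₀ x₀ hg₀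
  have hx₀ (b : X.A) : cocycle Φ g₀ (translate ((X.step t ^ (m + n)) b) x₀) = cocycle Φ g₀ x₀ :=
    hm _ _ (hmg₀ _) (translate_coord' (level_anti (Nat.le_add_right m n) ⟨b, rfl⟩) x₀)
  -- Apply the cocycle to both sides of `g₀ · z = (t z) · g₀` at `x₀`. Since `z = e ^ (m + n) a` is
  -- small, `g₀` contributes the same element, with linear part `s ^ j`, on both sides; moving it
  -- past the translation leaves the intertwining relation.
  have hfeq (a : X.A) : (f (X.step t ((X.step t ^ m) a)) : N) =
      (Y.σ ((s : H) ^ j)).toAdd (f ((X.step t ^ m) a)) := by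
    have h1 := cocycle_mul Φ (maps_translate (X.step t ((X.step t ^ (m + n)) a)) _) hg₀
    have h2 := cocycle_mul Φ (hmg₀ ((X.step t ^ (m + n)) a)) (maps_translate _ _)
    rw [mul_translation, hlin, ← coe_step, h1, hx₀] at h2
    have h3 := hfc ((X.step t ^ m) a) 0
    have h4 := hfc (X.step t ((X.step t ^ m) a)) 0
    rw [map_zero, translate_zero, ← end_pow_add_apply, add_comm n m] at h3
    rw [map_zero, translate_zero, ← end_pow_succ_apply', end_pow_succ_apply,
      ← end_pow_add_apply, add_comm n m] at h4
    rw [h3, h4, mul_translation, ← hj] at h2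
    exact translation_injective (mul_right_cancel h2)
  obtain ⟨e, he⟩ : ∃ e : X.A →+ X.A, ∀ a, e a = (X.step t ^ m) a :=
    ⟨X.step t ^ m, fun _ => rfl⟩
  have hfinj : Function.Injective (f.comp e) := by
    refine hf.comp fun a b hab => ?_
    rw [he, he] at hab
    exact step_pow_injective m hab
  have hj0 : j ≠ 0 := by
    rintro rfl
    refine hX.range_ne_top ((AddSubgroup.eq_top_iff' _).2 fun a => ⟨a, ?_⟩)
    refine hfinj (Subtype.ext ?_)
    have h1 := hfeq a
    rw [zpow_zero, map_one] at h1
    change (f (e (X.step t a)) : N) = f (e a)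
    rw [he, he, ← end_pow_succ_apply', end_pow_succ_apply]
    exact h1
  let y₀ := base Φ x₀
  -- The point `y₀` need not be `0`, but it inherits isotropy: the cocycle value of `g₀`, inverted
  -- if `j < 0`, is what the analysis of `Φ.symm` at `y₀` needs.
  obtain ⟨k₀, i, hi, hk₀, hklin⟩ : ∃ (k₀ : Y.AffineGroup) (i : ℕ), 0 < i ∧ Y.Maps k₀ y₀ y₀ ∧
      Y.linearPart k₀ = (s : H) ^ i := by
    have h1 := maps_cocycle Φ hg₀
    rcases Int.natAbs_eq j with h2 | h2
    · exact ⟨_, j.natAbs, Int.natAbs_pos.2 hj0, h1, by rw [← hj, ← zpow_natCast, ← h2]⟩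
    · exact ⟨_, j.natAbs, Int.natAbs_pos.2 hj0, h1.inv, by
        rw [map_inv, ← hj, ← zpow_natCast, ← zpow_neg]
        congr 1
        omega⟩
  obtain ⟨l₁, hl₁⟩ := exists_level_linearPart_cocycle Φ.symm hY hX hk₀ hi hklin
  -- `l₁` makes the preimage of a small translation a translation; `l₂` makes that preimage lie in
  -- `e ^ (n + m) A`, where `f` computes the cocycle.
  obtain ⟨l₂, hl₂⟩ := hY.exists_level_map (base Φ.symm).continuous y₀ (level t (n + m))
  refine ⟨j, f.comp e, hfinj, ⟨l₁ + l₂, ?_⟩, fun a => ?_⟩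
  · rintro _ ⟨d, rfl⟩
    let b : Y.A := (Y.step s ^ (l₁ + l₂)) d
    have h1 : X.linearPart (cocycle Φ.symm (Y.translation b) y₀) = 1 := by
      have := hl₁ ((Y.step s ^ l₂) d) 0
      rwa [map_zero, translate_zero, ← end_pow_add_apply] at this
    have h2 := maps_cocycle Φ.symm (maps_translate b y₀)
    have h3 : (base Φ.symm (translate b y₀)).1 (level t (n + m)) =
        (base Φ.symm y₀).1 (level t (n + m)) :=
      hl₂ _ (translate_coord' (level_anti (Nat.le_add_left l₂ l₁) ⟨d, rfl⟩) y₀)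
    rw [eq_translation h1] at h2
    obtain ⟨_, ⟨a, rfl⟩, ha⟩ := IsArithmetic.mem_of_maps_translation (n + m) h2 h3
    have h4 := cocycle_symm Φ.symm (maps_translate b y₀)
    rw [eq_translation h1, ← ha, base_symm_base] at h4
    refine ⟨a, Subtype.ext (translation_injective (X := Y) ?_)⟩
    have h5 := hfc ((X.step t ^ m) a) 0
    rw [map_zero, translate_zero, ← end_pow_add_apply] at h5
    change Y.translation (f (e a)) = _
    rw [he, ← h5]
    exact h4
  · change (f (e (X.step t a)) : N) = (Y.σ ((s : H) ^ j)).toAdd (f (e a))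
    rw [he, he, ← end_pow_succ_apply', end_pow_succ_apply]
    exact hfeq a

end GlobalizedAction

/-! ### Comparison of indices and extension to the globalizations. -/

namespace GlobalizedAction

variable {G M : Type u} [Group G] [AddCommGroup M] {X : GlobalizedAction G M} {t : X.S}
  {H N : Type v} [Group H] [AddCommGroup N] {Y : GlobalizedAction H N} {s : Y.S}

/-- An isomorphism of groupoids yields an injective homomorphism `f` with open image that
intertwines `t` with a positive power of `s`. -/
lemma exists_pos_intertwiner (Φ : TopGroupoid.Iso X.groupoid Y.groupoid)
    (hX : X.IsArithmetic t) (hY : Y.IsArithmetic s) :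
    ∃ j : ℕ, 0 < j ∧ ∃ f : X.A →+ Y.A, Function.Injective f ∧ (∃ l, (level s l).1 ≤ f.range) ∧
      ∀ a, f (X.step t a) = (Y.step s ^ j) (f a) := by
  obtain ⟨j, f, hf, hl, hfj⟩ := exists_intertwiner Φ hX hY
  obtain ⟨i, rfl | rfl⟩ := j.eq_nat_or_neg
  · refine ⟨i, Nat.pos_of_ne_zero ?_, f, hf, hl, fun a => Subtype.ext ?_⟩
    · rintro rfl
      refine hX.range_ne_top ((AddSubgroup.eq_top_iff' _).2 fun a => ⟨a, hf (Subtype.ext ?_)⟩)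
      exact (hfj a).trans (by rw [Nat.cast_zero, zpow_zero, map_one]; rfl)
    · rw [hfj, coe_step_pow, zpow_natCast]
  · exfalso
    have h1 (a : X.A) : f a = (Y.step s ^ i) (f (X.step t a)) := Subtype.ext <| by
      rw [coe_step_pow, hfj, zpow_neg, zpow_natCast, map_inv]
      exact ((Y.σ ((s : H) ^ i)).toAdd.apply_symm_apply _).symm
    have hi : 0 < i := by
      refine Nat.pos_of_ne_zero ?_
      rintro rfl
      exact hX.range_ne_top ((AddSubgroup.eq_top_iff' _).2 fun a => ⟨a, (hf (h1 a)).symm⟩)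
    -- Iterating `f a = s ^ i (f (t a))` with `i > 0` pushes `f a` into every level, so separation
    -- gives `f = 0`; then `A` is trivial, contrary to `e A ≠ A`.
    have h2 (n : ℕ) (a : X.A) : f a ∈ (level s n).1 := by
      induction n generalizing a with
      | zero => exact ⟨f a, rfl⟩
      | succ n ih =>
        obtain ⟨b, hb⟩ := ih (X.step t a)
        refine level_anti (show n + 1 ≤ i + n by omega) ⟨b, ?_⟩
        rw [h1 a, ← hb]
        exact end_pow_add_apply i n b
    refine hX.range_ne_top ((AddSubgroup.eq_top_iff' _).2 fun a => ⟨0, ?_⟩)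
    exact (map_zero (X.step t)).trans
      (hf ((map_zero f).trans (hY.separated _ fun n => h2 n a).symm))

/-- An injective homomorphism with image of finite index preserves the indices of intertwined
injective endomorphisms. -/
lemma index_eq_of_intertwiner (hY : Y.IsArithmetic s) {j l : ℕ} {f : X.A →+ Y.A}
    (hf : Function.Injective f) (hl : (level s l).1 ≤ f.range)
    (hfj : ∀ a, f (X.step t a) = (Y.step s ^ j) (f a)) :
    (AddMonoidHom.range (X.step t)).index = (AddMonoidHom.range (Y.step s)).index ^ j := by
  have hfin := hY.finiteIndex_level l
  have hD : f.range.index ≠ 0 := (AddSubgroup.finiteIndex_of_le hl).index_ne_zero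
  let q : Y.A →+ Y.A := (Y.step s ^ j : AddMonoid.End Y.A)
  have hq : Function.Injective q := step_pow_injective j
  have h1 : ((AddMonoidHom.range (X.step t)).map f).relIndex f.range =
      (AddMonoidHom.range (X.step t)).index := by
    rw [← AddSubgroup.relIndex_top_right, AddMonoidHom.range_eq_map f]
    exact AddSubgroup.relIndex_map_map_of_injective _ _ hf
  have h2 : (AddMonoidHom.range (X.step t)).map f = f.range.map q := by
    ext y
    constructor
    · rintro ⟨_, ⟨a, rfl⟩, rfl⟩
      exact ⟨f a, ⟨a, rfl⟩, (hfj a).symm⟩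
    · rintro ⟨_, ⟨a, rfl⟩, rfl⟩
      exact ⟨_, ⟨a, rfl⟩, hfj a⟩
  have h3 : f.range.map q ≤ f.range := by
    rw [← h2]
    rintro _ ⟨a, -, rfl⟩
    exact ⟨a, rfl⟩
  -- The index of `q (f A)` in `Y.A` is computed through `f A` and through `q (Y.A)`. The finite
  -- index of `f A` occurs in both products and cancels.
  have h4 : (f.range.map q).relIndex ((⊤ : AddSubgroup Y.A).map q) = f.range.index := by
    rw [AddSubgroup.relIndex_map_map_of_injective _ _ hq, AddSubgroup.relIndex_top_right]
  have h5 : (level s j).1 = (⊤ : AddSubgroup Y.A).map q := AddMonoidHom.range_eq_map _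
  have h6 := AddSubgroup.relIndex_mul_index h3
  have h7 := AddSubgroup.relIndex_mul_index (AddSubgroup.map_mono (f := q) (le_top : f.range ≤ ⊤))
  rw [h4, ← h5, index_level] at h7
  rw [← h2, h1, h2, ← h7, mul_comm] at h6
  exact Nat.eq_of_mul_eq_mul_left (Nat.pos_of_ne_zero hD) h6

lemma IsArithmetic.one_lt_index (hX : X.IsArithmetic t) :
    1 < (AddMonoidHom.range (X.step t)).index := by
  have := hX.finite_quotient
  have h0 := (AddSubgroup.finiteIndex_of_finite_quotient
    (H := AddMonoidHom.range (X.step t))).index_ne_zero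
  have h1 : (AddMonoidHom.range (X.step t)).index ≠ 1 := fun h =>
    hX.range_ne_top (AddSubgroup.index_eq_one.1 h)
  omega

lemma apply_pow_add (m n : ℕ) (x : M) : (X.σ ((t : G) ^ (m + n))).toAdd x =
    (X.σ ((t : G) ^ m)).toAdd ((X.σ ((t : G) ^ n)).toAdd x) := by
  rw [pow_add, map_mul]
  rfl

/-- An intertwiner with open image extends to an isomorphism of the globalizations. -/
lemma exists_extension (hX : X.IsArithmetic t) (hY : Y.IsArithmetic s) {f : X.A →+ Y.A}
    (hf : Function.Injective f) {l : ℕ} (hl : (level s l).1 ≤ f.range)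
    (hfs : ∀ a, f (X.step t a) = Y.step s (f a)) :
    ∃ b : M ≃+ N, ∀ x, b ((X.σ t).toAdd x) = (Y.σ s).toAdd (b x) := by
  have hpow (n : ℕ) (a : X.A) : f ((X.step t ^ n) a) = (Y.step s ^ n) (f a) := by
    induction n with
    | zero => rfl
    | succ n ih => rw [end_pow_succ_apply, end_pow_succ_apply, hfs, ih]
  -- The extension is `x ↦ s ^ (-n) f (t ^ n x)` for any `n` with `t ^ n x ∈ A`; `key` is its
  -- independence of `n`.
  have hex (x : M) : ∃ y : N, ∃ (n : ℕ) (a : X.A), (X.σ ((t : G) ^ n)).toAdd x = a ∧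
      (Y.σ ((s : H) ^ n)).toAdd y = f a := by
    obtain ⟨n, hn⟩ := hX.exists_mem x
    exact ⟨(Y.σ ((s : H) ^ n)).toAdd.symm (f ⟨_, hn⟩), n, ⟨_, hn⟩, rfl,
      (Y.σ ((s : H) ^ n)).toAdd.apply_symm_apply _⟩
  choose b n α hα hb using hex
  have key {x : M} {k : ℕ} {a : X.A} (hk : (X.σ ((t : G) ^ k)).toAdd x = a) :
      (Y.σ ((s : H) ^ k)).toAdd (b x) = f a := by
    have h1 : (X.step t ^ k) (α x) = (X.step t ^ n x) a := Subtype.ext <| by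
      rw [coe_step_pow, coe_step_pow, ← hα, ← hk, ← apply_pow_add, ← apply_pow_add, add_comm]
    have h2 := congrArg (fun a => (f a : N)) h1
    beta_reduce at h2
    rw [hpow, hpow, coe_step_pow, coe_step_pow, ← hb, ← apply_pow_add, add_comm,
      apply_pow_add] at h2
    exact (Y.σ ((s : H) ^ n x)).toAdd.injective h2
  have hstable (x : M) {k m : ℕ} (hkm : k ≤ m) {a : X.A}
      (hk : (X.σ ((t : G) ^ k)).toAdd x = a) :
      ∃ a' : X.A, (X.σ ((t : G) ^ m)).toAdd x = a' := by
    obtain ⟨i, rfl⟩ := Nat.exists_eq_add_of_le' hkm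
    exact ⟨(X.step t ^ i) a, by rw [coe_step_pow, ← hk, apply_pow_add]⟩
  let B : M →+ N := AddMonoidHom.mk' b fun x y => by
    obtain ⟨a, ha⟩ := hstable x (le_max_left (n x) (n y)) (hα x)
    obtain ⟨a', ha'⟩ := hstable y (le_max_right (n x) (n y)) (hα y)
    have h1 : (X.σ ((t : G) ^ (max (n x) (n y)))).toAdd (x + y) = (a + a' : X.A) := by
      rw [map_add, ha, ha', AddSubgroup.coe_add]
    refine (Y.σ ((s : H) ^ (max (n x) (n y)))).toAdd.injective ?_
    rw [key h1, map_add, map_add, key ha, key ha', AddSubgroup.coe_add]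
  have hinj : Function.Injective B := by
    refine (injective_iff_map_eq_zero _).2 fun x hx => ?_
    have h1 := hb x
    rw [show b x = 0 from hx, map_zero] at h1
    have h2 : α x = 0 := hf ((Subtype.ext h1.symm).trans (map_zero f).symm)
    have h3 := hα x
    rw [h2, AddSubgroup.coe_zero] at h3
    exact (X.σ ((t : G) ^ n x)).toAdd.injective (h3.trans (map_zero _).symm)
  have hsurj : Function.Surjective B := by
    intro y
    obtain ⟨m, hm⟩ := hY.exists_mem y
    -- `m` steps bring `y` into `Y.A`, and `l` more bring it into the image of `f`.
    obtain ⟨a, ha⟩ := hl ⟨⟨_, hm⟩, rfl⟩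
    refine ⟨(X.σ ((t : G) ^ (l + m))).toAdd.symm a, ?_⟩
    have h1 := key (x := (X.σ ((t : G) ^ (l + m))).toAdd.symm a)
      ((X.σ ((t : G) ^ (l + m))).toAdd.apply_symm_apply _)
    refine (Y.σ ((s : H) ^ (l + m))).toAdd.injective (h1.trans ?_)
    rw [ha, apply_pow_add]
    exact coe_step_pow l _
  refine ⟨AddEquiv.ofBijective B ⟨hinj, hsurj⟩, fun x => ?_⟩
  change b ((X.σ (t : G)).toAdd x) = (Y.σ (s : H)).toAdd (b x)
  have h1 : (X.σ ((t : G) ^ n x)).toAdd ((X.σ (t : G)).toAdd x) = X.step t (α x) := by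
    rw [coe_step, ← hα]
    have h2 := apply_pow_add (X := X) (t := t) (n x) 1 x
    have h3 := apply_pow_add (X := X) (t := t) 1 (n x) x
    rw [add_comm, h2, pow_one] at h3
    exact h3
  refine (Y.σ ((s : H) ^ n x)).toAdd.injective ((key h1).trans ?_)
  rw [hfs, coe_step, ← hb]
  have h2 := apply_pow_add (X := Y) (t := s) (n x) 1 (b x)
  have h3 := apply_pow_add (X := Y) (t := s) 1 (n x) (b x)
  rw [add_comm, h2, pow_one] at h3
  exact h3.symm

/-- Rigidity: isomorphic groupoids come from conjugate globalizations. -/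
theorem exists_conjugacy (Φ : TopGroupoid.Iso X.groupoid Y.groupoid)
    (hX : X.IsArithmetic t) (hY : Y.IsArithmetic s) :
    ∃ b : M ≃+ N, ∀ x, b ((X.σ t).toAdd x) = (Y.σ s).toAdd (b x) := by
  obtain ⟨j, hj, f, hf, ⟨l, hl⟩, hfj⟩ := exists_pos_intertwiner Φ hX hY
  obtain ⟨i, hi, f', hf', ⟨l', hl'⟩, hfi⟩ := exists_pos_intertwiner Φ.symm hY hX
  have h1 := index_eq_of_intertwiner hY hf hl hfj
  have h2 := index_eq_of_intertwiner hX hf' hl' hfi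
  rw [h2, ← pow_mul] at h1
  -- The index of `e A` exceeds 1 and equals its own power with exponent `i * j`. The second
  -- intertwiner is needed only for this.
  have h3 : i * j = 1 :=
    (Nat.pow_right_injective hX.one_lt_index ((pow_one _).trans h1)).symm
  obtain rfl : j = 1 := Nat.eq_one_of_mul_eq_one_left h3
  exact exists_extension hX hY hf hl fun a => by rw [hfj, pow_one]

end GlobalizedAction

/-! ### Arithmeticity for multiplication by a ring element. -/

namespace GlobalizedAction

variable {G M : Type u} [Group G] [AddCommGroup M] {X : GlobalizedAction G M} {t : X.S}

lemma step_pow_apply_of_ring {R : Type*} [CommRing R] {ι : R →+ X.A} {ξ : R}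
    (hstep : ∀ x, X.step t (ι x) = ι (ξ * x)) (n : ℕ) (x : R) :
    (X.step t ^ n) (ι x) = ι (ξ ^ n * x) := by
  induction n with
  | zero => rw [pow_zero, pow_zero, one_mul]; rfl
  | succ n ih => rw [end_pow_succ_apply, ih, hstep, pow_succ', mul_assoc]

/-- A criterion for arithmeticity when `t` acts on `A` as multiplication by a ring element. -/
lemma IsArithmetic.of_ring {O R : Type*} [CommRing O] [CommRing R] [Module.Finite ℤ O]
    (φ : O →+* R) (ξ : O) (ι : R →+ X.A) (hι : Function.Bijective ι)
    (hstep : ∀ x, X.step t (ι x) = ι (φ ξ * x))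
    (hpow : X.S = Submonoid.powers (t : G))
    (hmem : ∀ m, ∃ n : ℕ, (X.σ ((t : G) ^ n)).toAdd m ∈ X.A)
    (hfin : Finite (O ⧸ Ideal.span {ξ}))
    (hdense : ∀ x, ∃ y z, x = φ y + φ ξ * z) (hunit : ¬ IsUnit (φ ξ))
    (hsep : ∀ x, (∀ n, φ ξ ^ n ∣ x) → x = 0)
    (hint : ∀ j, 0 < j → ∃ N : ℤ, N ≠ 0 ∧ ∃ r : O, (N : O) = (ξ ^ j - 1) * r) :
    X.IsArithmetic t where
  eq_powers := hpow
  exists_mem := hmem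
  finite_quotient := by
    refine Finite.of_surjective (fun q : O ⧸ Ideal.span {ξ} =>
      (ι (φ q.out) : X.A ⧸ AddMonoidHom.range (X.step t))) fun q => ?_
    obtain ⟨a, rfl⟩ := QuotientAddGroup.mk_surjective q
    obtain ⟨x, rfl⟩ := hι.2 a
    obtain ⟨y, z, rfl⟩ := hdense x
    obtain ⟨w, hw⟩ := Ideal.mem_span_singleton'.1
      (Ideal.Quotient.eq.1 (Quotient.out_eq (Ideal.Quotient.mk (Ideal.span {ξ}) y)))
    refine ⟨Ideal.Quotient.mk _ y, QuotientAddGroup.eq_iff_sub_mem.2 ⟨ι (φ w - z), ?_⟩⟩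
    refine (hstep _).trans ?_
    rw [← map_sub, ← sub_sub, ← map_sub φ, ← hw, map_mul φ]
    congr 1
    ring
  range_ne_top h := by
    obtain ⟨a, ha⟩ : ι 1 ∈ AddMonoidHom.range (X.step t) := h ▸ AddSubgroup.mem_top _
    obtain ⟨x, rfl⟩ := hι.2 a
    exact hunit (IsUnit.of_mul_eq_one x (hι.1 ((hstep x).symm.trans ha)))
  separated a ha := by
    obtain ⟨x, rfl⟩ := hι.2 a
    rw [hsep x fun n => ?_, map_zero]
    obtain ⟨b, hb⟩ := ha n
    obtain ⟨y, rfl⟩ := hι.2 b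
    exact ⟨y, hι.1 (hb.symm.trans (step_pow_apply_of_ring hstep n y))⟩
  exists_fg := by
    have hfg : AddGroup.FG O := Module.Finite.iff_addGroup_fg.1 inferInstance
    refine ⟨(ι.comp φ.toAddMonoidHom).range,
      (AddGroup.fg_iff_addSubgroup_fg _).1 (AddGroup.fg_range _), ?_, ?_⟩
    · rintro _ ⟨_, ⟨y, rfl⟩, rfl⟩
      exact ⟨ξ * y, (congrArg ι (map_mul φ ξ y)).trans (hstep _).symm⟩
    · refine (AddSubgroup.eq_top_iff' _).2 fun a => ?_
      obtain ⟨x, rfl⟩ := hι.2 a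
      obtain ⟨y, z, rfl⟩ := hdense x
      rw [map_add, ← hstep]
      exact AddSubgroup.add_mem_sup ⟨y, rfl⟩ ⟨_, rfl⟩
  exists_int j hj := by
    obtain ⟨N, hN, r, hr⟩ := hint j hj
    let e := AddEquiv.ofBijective ι hι
    let ρ : X.A →+ X.A := ι.comp ((AddMonoidHom.mulLeft (φ r)).comp e.symm.toAddMonoidHom)
    refine ⟨N, hN, ρ, fun a => ?_⟩
    obtain ⟨x, rfl⟩ := hι.2 a
    have h1 : ρ (ι x) = ι (φ r * x) := by
      change ι (φ r * e.symm (e x)) = _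
      rw [AddEquiv.symm_apply_apply]
    refine Eq.trans ?_ (congrArg₂ (· - ·) ((congrArg _ h1).trans
      (step_pow_apply_of_ring hstep j _)) h1).symm
    have h2 := congrArg φ hr
    rw [map_intCast, map_mul, map_sub, map_pow, map_one] at h2
    rw [← map_zsmul, ← map_sub, zsmul_eq_mul, h2]
    congr 1
    ring

end GlobalizedAction

/-! ### Verification for rings of `S`-integers. -/

namespace SIntegerSystem

section Arithmetic

variable {K : Type u} [Field K] [NumberField K] {S : Set (HeightOneSpectrum (𝓞 K))} {ξ : 𝓞 K}

/-- Otherwise all valuations of `ξ` outside `S` are 1, and `ξ⁻¹` is an `S`-integer. -/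
lemma exists_valuation_lt_one (hξ : ξ ≠ 0)
    (hξS : ¬ IsUnit (algebraMap (𝓞 K) (S.integer K) ξ)) :
    ∃ v ∉ S, v.valuation K (ξ : K) < 1 := by
  by_contra! hcon
  have h1 (v : HeightOneSpectrum (𝓞 K)) (hv : v ∉ S) : v.valuation K (ξ : K) = 1 :=
    le_antisymm (v.valuation_le_one ξ) (hcon v hv)
  have hξK : (ξ : K) ≠ 0 := by simpa using hξ
  refine hξS (IsUnit.of_mul_eq_one (⟨(ξ : K)⁻¹, fun v hv => ?_⟩ : S.integer K)
    (Subtype.ext (mul_inv_cancel₀ hξK)))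
  rw [map_inv₀, h1 v hv, inv_one]

/-- Every `S`-integer is congruent modulo `ξ` to an integer. -/
lemma exists_integer_sub_mem (hξ : ξ ≠ 0) (x : S.integer K) :
    ∃ (y : 𝓞 K) (z : S.integer K),
      x = algebraMap (𝓞 K) (S.integer K) y + algebraMap (𝓞 K) (S.integer K) ξ * z := by
  classical
  have hξK : (ξ : K) ≠ 0 := by simpa using hξ
  have hfin := Ideal.finite_factors (I := Ideal.span {ξ}) (by simpa using hξ)
  -- Only the finitely many primes outside `S` that divide `ξ` impose a congruence. Local
  -- approximations of `x` at these primes are glued by the Chinese remainder theorem; at the other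
  -- primes outside `S`, `ξ` is a local unit and integrality suffices.
  let s : Finset (HeightOneSpectrum (𝓞 K)) := hfin.toFinset.filter (· ∉ S)
  have hlocal (v : HeightOneSpectrum (𝓞 K)) : ∃ a : 𝓞 K, v ∉ S →
      v.valuation K ((a : K) - x) ≤ v.valuation K (ξ : K) := by
    by_cases hv : v ∈ S
    · exact ⟨0, fun h => absurd hv h⟩
    · obtain ⟨a, ha⟩ := v.exists_valuation_sub_lt_of_integer (x.2 v hv)
        (Units.mk0 (v.valuation K (ξ : K)) (by simpa using hξK))
      exact ⟨a, fun _ => ha.le⟩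
  choose a ha using hlocal
  have hval (v : HeightOneSpectrum (𝓞 K)) : ∃ n : ℕ,
      v.valuation K (ξ : K) = WithZero.exp (-(n : ℤ)) :=
    ⟨_, (v.valuation_of_algebraMap ξ).trans (v.intValuation_if_neg hξ)⟩
  choose e he using hval
  obtain ⟨y, hy⟩ := exists_forall_sub_mem_ideal (s := s) (fun v => v.asIdeal) e
    (fun v _ => v.prime) (fun v _ w _ hvw h => hvw (HeightOneSpectrum.ext h)) (fun v => a v)
  have hdiv (v : HeightOneSpectrum (𝓞 K)) (hv : v ∉ S) :
      v.valuation K ((x : K) - y) ≤ v.valuation K (ξ : K) := by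
    by_cases hvξ : v ∈ s
    · have h1 : v.valuation K ((y : K) - a v) ≤ v.valuation K (ξ : K) := by
        have h2 := (v.intValuation_le_pow_iff_mem _ _).2 (hy v hvξ)
        rw [← v.valuation_of_algebraMap (K := K), ← he] at h2
        exact h2
      have h3 : (x : K) - y = -(((y : K) - a v) + ((a v : K) - x)) := by ring
      rw [h3, Valuation.map_neg]
      exact Valuation.map_add_le _ h1 (ha v hv)
    · have h1 : v.valuation K (ξ : K) = 1 := by
        refine v.valuation_eq_one_iff_notMem.2 fun hmem => hvξ ?_
        simp only [s, Finset.mem_filter, Set.Finite.mem_toFinset]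
        exact ⟨Ideal.dvd_span_singleton.2 hmem, hv⟩
      rw [h1]
      exact Valuation.map_sub_le _ (x.2 v hv) (v.valuation_le_one y)
  refine ⟨y, ⟨(ξ : K)⁻¹ * ((x : K) - y), fun v hv => ?_⟩, Subtype.ext ?_⟩
  · rw [map_mul, map_inv₀]
    exact inv_mul_le_one_of_le₀ (hdiv v hv) zero_le
  · change (x : K) = (y : K) + (ξ : K) * ((ξ : K)⁻¹ * ((x : K) - y))
    rw [mul_inv_cancel_left₀ hξK]
    ring

/-- At a prime outside `S` with `v(ξ) < 1`, divisibility gives `v(x) ≤ v(ξ) ^ n` for all `n`. -/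
lemma eq_zero_of_forall_dvd (hξ : ξ ≠ 0)
    (hξS : ¬ IsUnit (algebraMap (𝓞 K) (S.integer K) ξ)) {x : S.integer K}
    (hx : ∀ n, algebraMap (𝓞 K) (S.integer K) ξ ^ n ∣ x) : x = 0 := by
  obtain ⟨v, hv, hvξ⟩ := exists_valuation_lt_one hξ hξS
  by_contra hx0
  have h0 : v.valuation K (x : K) ≠ 0 := by simpa using hx0
  obtain ⟨n, hn⟩ := exists_pow_lt₀ hvξ (Units.mk0 _ h0)
  obtain ⟨y, rfl⟩ := hx n
  refine hn.not_ge ?_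
  change v.valuation K ((ξ : K) ^ n * y) ≤ _
  rw [map_mul, map_pow]
  exact mul_le_of_le_one_right' (y.2 v hv)

/-- The absolute norm of a non-zero ideal is a non-zero integer in that ideal. -/
lemma exists_int_eq_mul {δ : 𝓞 K} (hδ : δ ≠ 0) :
    ∃ N : ℤ, N ≠ 0 ∧ ∃ r : 𝓞 K, (N : 𝓞 K) = δ * r := by
  have hbot : Ideal.span {δ} ≠ ⊥ := by simpa using hδ
  obtain ⟨r, hr⟩ := Ideal.mem_span_singleton'.1 (Ideal.absNorm_mem (Ideal.span {δ}))
  refine ⟨Ideal.absNorm (Ideal.span {δ}), ?_, r, ?_⟩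
  · exact_mod_cast Ideal.absNorm_ne_zero_iff _ |>.2 (Ideal.finiteQuotientOfFreeOfNeBot _ hbot)
  · rw [Int.cast_natCast, ← hr, mul_comm]

end Arithmetic

variable (K : Type u) [Field K] [NumberField K] (S : Set (HeightOneSpectrum (𝓞 K)))
  (ξ : 𝓞 K) (hξ : ξ ≠ 0)

/-- The generator of the monoid `{1, ξ, ξ², …}`. -/
def gen : (globalizedAction K S ξ hξ).S :=
  ⟨⟨unit K S ξ hξ, Subgroup.mem_zpowers _⟩, Submonoid.mem_powers _⟩

lemma exists_pow_mul_eq (x : away K S ξ) : ∃ (n : ℕ) (r : S.integer K), (ξ : K) ^ n * x = r := by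
  obtain ⟨x, hx⟩ := x
  induction hx using Algebra.adjoin_induction with
  | mem x hx =>
    obtain rfl := hx
    -- The statement does not assume `ξ ≠ 0`; for `ξ = 0` the adjoined inverse is `0`.
    by_cases h : (ξ : K) = 0
    · exact ⟨0, 0, by simp [h]⟩
    · exact ⟨1, 1, by simp [h]⟩
  | algebraMap r => exact ⟨0, r, by rw [pow_zero, one_mul]; rfl⟩
  | add x y _ _ ihx ihy =>
    obtain ⟨n, r, hr⟩ := ihx
    obtain ⟨m, r', hr'⟩ := ihy
    refine ⟨n + m, algebraMap (𝓞 K) (S.integer K) ξ ^ m * r +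
      algebraMap (𝓞 K) (S.integer K) ξ ^ n * r', ?_⟩
    change (ξ : K) ^ (n + m) * (x + y) = (ξ : K) ^ m * r + (ξ : K) ^ n * r'
    rw [← hr, ← hr']
    ring
  | mul x y _ _ ihx ihy =>
    obtain ⟨n, r, hr⟩ := ihx
    obtain ⟨m, r', hr'⟩ := ihy
    refine ⟨n + m, r * r', ?_⟩
    change (ξ : K) ^ (n + m) * (x * y) = r * r'
    rw [← hr, ← hr']
    ring

theorem isArithmetic (hξS : ¬ IsUnit (algebraMap (𝓞 K) (S.integer K) ξ)) :
    (globalizedAction K S ξ hξ).IsArithmetic (gen K S ξ hξ) := by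
  have hinj : Function.Injective (algebraMap (S.integer K) (away K S ξ)) := fun x y hxy =>
    Subtype.ext (congrArg (Subtype.val : away K S ξ → K) hxy)
  refine GlobalizedAction.IsArithmetic.of_ring (algebraMap (𝓞 K) (S.integer K)) ξ
    (AddMonoidHom.rangeRestrict (algebraMap (S.integer K) (away K S ξ)).toAddMonoidHom)
    ⟨fun x y hxy => hinj (congrArg Subtype.val hxy), AddMonoidHom.rangeRestrict_surjective _⟩
    (fun x => Subtype.ext (map_mul (algebraMap (S.integer K) (away K S ξ)) _ x).symm) rfl
    (fun m => ?_) (Ideal.finiteQuotientOfFreeOfNeBot _ (by simpa using hξ))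
    (exists_integer_sub_mem hξ) hξS (fun x => eq_zero_of_forall_dvd hξ hξS)
    (fun j hj => exists_int_eq_mul fun h => hξS ?_)
  · obtain ⟨n, r, hr⟩ := exists_pow_mul_eq K S ξ m
    refine ⟨n, r, Subtype.ext ?_⟩
    have h1 : (((unit K S ξ hξ ^ n : (away K S ξ)ˣ) : away K S ξ) : K) = (ξ : K) ^ n := by
      rw [Units.val_pow_eq_pow_val]
      rfl
    change (r : K) = (((unit K S ξ hξ ^ n : (away K S ξ)ˣ) : away K S ξ) : K) * m
    rw [h1, hr]
  -- `ξ ^ j - 1` is non-zero since a root of unity would be a unit.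
  · exact IsUnit.map _ (IsUnit.of_pow_eq_one (sub_eq_zero.1 h) hj.ne')

end SIntegerSystem

/-! ### From the conjugacy to finite algebraic equivalence. -/

/-- Conjugacy of two automorphisms gives conjugacy of the `ℤ`-actions that they generate. -/
lemma SIntegerSystem.exists_algebraicEmbedding {M N : Type*} [AddCommGroup M] [AddCommGroup N]
    {σ : Multiplicative ℤ →* Multiplicative (AddAut M)}
    {τ : Multiplicative ℤ →* Multiplicative (AddAut N)} (b : M ≃+ N)
    (hb : ∀ x, b ((σ (Multiplicative.ofAdd 1)).toAdd x) =
      (τ (Multiplicative.ofAdd 1)).toAdd (b x)) :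
    ∃ e : AlgebraicEmbedding σ τ, Function.Bijective e.t ∧ e.b.range.FiniteIndex := by
  have hnat (n : ℕ) (x : M) : b ((σ (Multiplicative.ofAdd (n : ℤ))).toAdd x) =
      (τ (Multiplicative.ofAdd (n : ℤ))).toAdd (b x) := by
    induction n generalizing x with
    | zero => rw [Nat.cast_zero, ofAdd_zero, map_one σ, map_one τ]; rfl
    | succ n ih =>
      rw [Nat.cast_succ, ofAdd_add, map_mul σ, map_mul τ]
      exact (ih _).trans (congrArg _ (hb x))
  have hneg (n : ℕ) (x : M) : b ((σ (Multiplicative.ofAdd (-n : ℤ))).toAdd x) =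
      (τ (Multiplicative.ofAdd (-n : ℤ))).toAdd (b x) := by
    rw [ofAdd_neg, map_inv σ, map_inv τ]
    refine ((τ (Multiplicative.ofAdd (n : ℤ))).toAdd.eq_symm_apply).2 ((hnat n _).symm.trans ?_)
    exact congrArg b ((σ (Multiplicative.ofAdd (n : ℤ))).toAdd.apply_symm_apply x)
  have hb' (g : Multiplicative ℤ) (x : M) : b ((σ g).toAdd x) = (τ g).toAdd (b x) := by
    obtain ⟨n, h | h⟩ := g.toAdd.eq_nat_or_neg
    · exact (show g = Multiplicative.ofAdd (n : ℤ) from h) ▸ hnat n x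
    · exact (show g = Multiplicative.ofAdd (-n : ℤ) from h) ▸ hneg n x
  refine ⟨⟨MonoidHom.id _, b.toAddMonoidHom, Function.injective_id, b.injective, hb'⟩,
    Function.bijective_id, ?_⟩
  have h1 : b.toAddMonoidHom.range = ⊤ := AddMonoidHom.range_eq_top.2 b.surjective
  exact h1 ▸ inferInstance

end

theorem mainTheorem11
    (K₁ : Type u) [Field K₁] [NumberField K₁] (K₂ : Type v) [Field K₂] [NumberField K₂]
    (S : Set (HeightOneSpectrum (𝓞 K₁))) (T : Set (HeightOneSpectrum (𝓞 K₂)))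
    (_hS : S ⊂ Set.univ) (_hT : T ⊂ Set.univ)
    (ξ : 𝓞 K₁) (hξ : ξ ≠ 0) (_hξS : ¬ IsUnit (algebraMap (𝓞 K₁) (S.integer K₁) ξ))
    (η : 𝓞 K₂) (hη : η ≠ 0) (_hηT : ¬ IsUnit (algebraMap (𝓞 K₂) (T.integer K₂) η))
    (_hiso : Nonempty (TopGroupoid.Iso
      (SIntegerSystem.groupoid K₁ S ξ hξ) (SIntegerSystem.groupoid K₂ T η hη))) :
    FinitelyAlgebraicallyEquivalent
      (SIntegerSystem.intAction K₁ S ξ hξ) (SIntegerSystem.intAction K₂ T η hη) := by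
  obtain ⟨Φ⟩ := _hiso
  obtain ⟨b, hb⟩ := GlobalizedAction.exists_conjugacy Φ
    (SIntegerSystem.isArithmetic K₁ S ξ hξ _hξS) (SIntegerSystem.isArithmetic K₂ T η hη _hηT)
  have h₁ (x : SIntegerSystem.away K₁ S ξ) :
      (SIntegerSystem.intAction K₁ S ξ hξ (Multiplicative.ofAdd 1)).toAdd x =
        ((SIntegerSystem.globalizedAction K₁ S ξ hξ).σ
          (SIntegerSystem.gen K₁ S ξ hξ : SIntegerSystem.zpowersXi K₁ S ξ hξ)).toAdd x :=
    congrArg (fun u : (SIntegerSystem.away K₁ S ξ)ˣ => (u : SIntegerSystem.away K₁ S ξ) * x)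
      (zpow_one (SIntegerSystem.unit K₁ S ξ hξ))
  have h₂ (x : SIntegerSystem.away K₂ T η) :
      (SIntegerSystem.intAction K₂ T η hη (Multiplicative.ofAdd 1)).toAdd x =
        ((SIntegerSystem.globalizedAction K₂ T η hη).σ
          (SIntegerSystem.gen K₂ T η hη : SIntegerSystem.zpowersXi K₂ T η hη)).toAdd x :=
    congrArg (fun u : (SIntegerSystem.away K₂ T η)ˣ => (u : SIntegerSystem.away K₂ T η) * x)
      (zpow_one (SIntegerSystem.unit K₂ T η hη))
  have hb₁ (x) : b ((SIntegerSystem.intAction K₁ S ξ hξ (Multiplicative.ofAdd 1)).toAdd x) =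
      (SIntegerSystem.intAction K₂ T η hη (Multiplicative.ofAdd 1)).toAdd (b x) := by
    rw [h₁, h₂, hb]
  refine ⟨SIntegerSystem.exists_algebraicEmbedding b hb₁,
    SIntegerSystem.exists_algebraicEmbedding b.symm fun x => ?_⟩
  rw [AddEquiv.symm_apply_eq, hb₁, AddEquiv.apply_symm_apply]
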